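/- Let $\alpha\in(1,2)$ and let $Z_\alpha$ be an independently scattered symmetric $\alpha$-stable ($\mathcal S\alpha\mathcal S$) random measure on $\mathbb R$ with Lebesgue control measure, defined on a probability space $(\Omega,\mathcal F,\mathbb P)$; that is, for Borel sets of finite Lebesgue measure $|A|$, the random variable $Z_\alpha(A)$ has characteristic function $t\mapsto e^{-|A||t|^\alpha}$, the values of $Z_\alpha$ on disjoint sets are independent, and $Z_\alpha$ is almost surely $\sigma$-additive on each disjoint sequence whose union has finite measure. For $f\in L^\alpha(\mathbb R)$, $\int f\,dZ_\alpha$ is the limit in probability of $\int f_n\,dZ_\alpha$ for simple functions $f_n\to f$ in $L^\alpha(\mathbb R)$. Write $(s)_+^\kappa=s^\kappa$ if $s>0$ and $(s)_+^\kappa=0$ if $s\le 0$, let $h=\mathbf 1_{[0,1/2)}-\mathbf 1_{[1/2,1)}$ be the Haar wavelet, and put, for $x\in\mathbb R$, $v\in(1/\alpha,1)$ and $j,k\in\mathbb Z$, $$\theta(x,v)=\int_{\mathbb R}(x-s)_+^{v-1/\alpha}h(s)\,ds,\qquad \zeta_{j,k}=2^{j/\alpha}\int_{\mathbb R}h(2^js-k)\,Z_\alpha(ds).$$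 For $J\in\mathbb N$ let $$X_2^J(u,v)=\sum_{j=1-J}^{J-1}2^{-jv}\sum_{k=1}^{2^{J-|j|}}\zeta_{j,-k}\bigl(\theta(2^ju+k,v)-\theta(k,v)\bigr).$$ Then there is an event $E$ of probability $1$ such that, for all real $a,b$ with $1/\alpha<a<b<1$, the following holds. The paths of each $X_2^J$ belong to the space $\mathcal C=\mathcal C([0,1]\times[a,b],\mathbb R)$ with the supremum norm $\|\cdot\|_{\mathcal C}$, and there is a random field $X_2=\{X_2(u,v):(u,v)\in[0,1]\times[a,b]\}$ with paths in $\mathcal C$ such that, for every $\omega\in E$, the sequence $(X_2^J(\cdot,\cdot,\omega))_{J}$ converges in $\mathcal C$ to $X_2(\cdot,\cdot,\omega)$ and, for every $\eta>0$, $$\bigl\|X_2(\cdot,\cdot,\omega)-X_2^J(\cdot,\cdot,\omega)\bigr\|_{\mathcal C}=\mathcal O\bigl(2^{-J(1-b)}J^{1/\alpha+\eta}\bigr)\qquad (J\to\infty).$$ Moreover $X_2$ is an $\mathcal S\alpha\mathcal S$ field (all finite linear combinations of its values are $\mathcal S\alpha\mathcal S$ random variables), and it is a modification of the low frequency part: for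 every $(u,v)\in[0,1]\times[a,b]$, almost surely, $$X_2(u,v)=\int_{-\infty}^0\bigl\{(u-s)_+^{v-1/\alpha}-(-s)_+^{v-1/\alpha}\bigr\}\,Z_\alpha(ds).$$ -/

import Mathlib

open MeasureTheory ProbabilityTheory Filter Topology Set

noncomputable section

namespace HaarLMSM

/-- `(s)_+^κ`: equal to `s ^ κ` for `s > 0` and to `0` for `s ≤ 0`. -/
def posPow (s κ : ℝ) : ℝ := if 0 < s then s ^ κ else 0

/-- The Haar mother wavelet `1_{[0,1/2)} - 1_{[1/2,1)}`, as a simple function. -/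
def haar : SimpleFunc ℝ ℝ :=
  SimpleFunc.piecewise (Ico (0 : ℝ) (1 / 2)) measurableSet_Ico (SimpleFunc.const ℝ 1)
    (SimpleFunc.piecewise (Ico (1 / 2 : ℝ) 1) measurableSet_Ico
      (SimpleFunc.const ℝ (-1)) (SimpleFunc.const ℝ 0))

theorem haar_apply (s : ℝ) :
    haar s = (Ico (0 : ℝ) (1 / 2)).indicator (fun _ => (1 : ℝ)) s
      - (Ico (1 / 2 : ℝ) 1).indicator (fun _ => (1 : ℝ)) s := by
  by_cases h1 : s ∈ Ico (0 : ℝ) (1 / 2)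
  · have h2 : s ∉ Ico (1 / 2 : ℝ) 1 := fun h => absurd h.1 (not_le.mpr h1.2)
    rw [indicator_of_mem h1, indicator_of_notMem h2]
    simp only [haar, SimpleFunc.piecewise_apply, h1, if_true, SimpleFunc.const_apply, sub_zero]
  · by_cases h2 : s ∈ Ico (1 / 2 : ℝ) 1
    · rw [indicator_of_notMem h1, indicator_of_mem h2]
      simp only [haar, SimpleFunc.piecewise_apply, h1, h2, if_true, if_false,
        SimpleFunc.const_apply, zero_sub]
    · rw [indicator_of_notMem h1, indicator_of_notMem h2]
      simp only [haar, SimpleFunc.piecewise_apply, h1, h2, if_false,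
        SimpleFunc.const_apply, sub_zero]

/-- `θ(x,v) = ∫ (x-s)_+^{v-1/α} h(s) ds`. -/
def theta (α x v : ℝ) : ℝ := ∫ s : ℝ, posPow (x - s) (v - 1 / α) * haar s

/-- `X` is a symmetric `α`-stable random variable with scale parameter `σ`:
its characteristic function is `t ↦ exp (-σ^α |t|^α)`. -/
def IsSymStable {Ω : Type*} [MeasurableSpace Ω] (P : Measure Ω) (α σ : ℝ) (X : Ω → ℝ) : Prop :=
  ∀ t : ℝ, charFun (P.map X) t = Complex.exp (-((σ ^ α * |t| ^ α : ℝ) : ℂ))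

/-- `Z` is an independently scattered symmetric `α`-stable random measure on `ℝ` whose control
measure is Lebesgue measure. It is a set function on the Borel sets of finite Lebesgue measure
(values on other sets are irrelevant). The series in `sigma_additive` converges almost surely
as a sequence of partial sums; in general it does not converge absolutely. -/
structure IsStableRandomMeasure {Ω : Type*} [MeasurableSpace Ω] (P : Measure Ω) (α : ℝ)
    (Z : Set ℝ → Ω → ℝ) : Prop where
  measurable : ∀ A : Set ℝ, MeasurableSet A → volume A ≠ ⊤ → Measurable (Z A)
  symStable : ∀ A : Set ℝ, MeasurableSet A → volume A ≠ ⊤ →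
    IsSymStable P α ((volume A).toReal ^ (1 / α)) (Z A)
  independent : ∀ (n : ℕ) (A : Fin n → Set ℝ), (∀ i, MeasurableSet (A i)) →
    (∀ i, volume (A i) ≠ ⊤) → Pairwise (fun i j => Disjoint (A i) (A j)) →
    iIndepFun (fun i => Z (A i)) P
  sigma_additive : ∀ A : ℕ → Set ℝ, (∀ i, MeasurableSet (A i)) →
    volume (⋃ i, A i) ≠ ⊤ → Pairwise (fun i j => Disjoint (A i) (A j)) →
    ∀ᵐ ω ∂P, Tendsto (fun n : ℕ => ∑ i ∈ Finset.range n, Z (A i) ω) atTop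
      (𝓝 (Z (⋃ i, A i) ω))

/-- The stochastic integral `∑ c, c Z(f = c)` of a simple function `f`. -/
def simpleIntegral {Ω : Type*} (Z : Set ℝ → Ω → ℝ) (f : SimpleFunc ℝ ℝ) (ω : Ω) : ℝ :=
  ∑ c ∈ f.range, c * Z (f ⁻¹' {c}) ω

/-- `Y` is (a version of) the stochastic integral `∫ f dZ`: the function `f` is in `L^α(ℝ)`, and
`Y` is the limit in probability of the integrals of any simple functions in `L^α(ℝ)` that
converge to `f` in `L^α(ℝ)`. -/
def HasStableIntegral {Ω : Type*} [MeasurableSpace Ω] (P : Measure Ω) (α : ℝ)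
    (Z : Set ℝ → Ω → ℝ) (f : ℝ → ℝ) (Y : Ω → ℝ) : Prop :=
  MemLp f (ENNReal.ofReal α) volume ∧
  ∀ g : ℕ → SimpleFunc ℝ ℝ, (∀ n, MemLp (g n) (ENNReal.ofReal α) volume) →
    Tendsto (fun n => eLpNorm (fun s => g n s - f s) (ENNReal.ofReal α) volume) atTop (𝓝 0) →
    TendstoInMeasure P (fun n => simpleIntegral Z (g n)) atTop Y

/-- `ζ_{j,k} = 2^{j/α} ∫ h(2^j s - k) Z(ds)`. -/
def zeta {Ω : Type*} (α : ℝ) (Z : Set ℝ → Ω → ℝ) (j k : ℤ) (ω : Ω) : ℝ :=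
  (2 : ℝ) ^ ((j : ℝ) / α) *
    simpleIntegral Z
      (haar.comp (fun s : ℝ => (2 : ℝ) ^ j * s - (k : ℝ))
        ((measurable_const.mul measurable_id).sub measurable_const)) ω

/-- `X₂^J(u,v) = ∑_{j=1-J}^{J-1} 2^{-jv} ∑_{k=1}^{2^{J-|j|}} ζ_{j,-k} (θ(2^j u + k, v) - θ(k, v))`;
the exponent `J - |j|` is positive for all the `j` that occur. -/
def haarLowSum {Ω : Type*} (α : ℝ) (Z : Set ℝ → Ω → ℝ) (J : ℕ) (u v : ℝ) (ω : Ω) : ℝ :=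
  ∑ j ∈ Finset.Icc (1 - (J : ℤ)) ((J : ℤ) - 1), (2 : ℝ) ^ (-(j : ℝ) * v) *
    ∑ k ∈ Finset.Icc (1 : ℕ) (2 ^ (J - j.natAbs)),
      zeta α Z j (-(k : ℤ)) ω * (theta α ((2 : ℝ) ^ j * u + k) v - theta α k v)

/-- The integrand `1_{(-∞,0]}(s) {(u-s)_+^{v-1/α} - (-s)_+^{v-1/α}}` of the low frequency part. -/
def lowKernel (α u v : ℝ) : ℝ → ℝ :=
  (Iic (0 : ℝ)).indicator fun s => posPow (u - s) (v - 1 / α) - posPow (-s) (v - 1 / α)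

/-- The random field `X` is symmetric `α`-stable: all finite linear combinations of its values are
symmetric `α`-stable random variables. -/
def IsSymStableField {Ω T : Type*} [MeasurableSpace Ω] (P : Measure Ω) (α : ℝ)
    (X : T → Ω → ℝ) : Prop :=
  ∀ (n : ℕ) (p : Fin n → T) (c : Fin n → ℝ),
    ∃ σ : ℝ, 0 ≤ σ ∧ IsSymStable P α σ (fun ω => ∑ i, c i * X (p i) ω)

end HaarLMSM

end

/-! Put κ = v - 1/α. The Haar coefficients of the kernel `lowKernel` are multiples of θ(2^j u + k,
v) - θ(k, v), so X₂^J(u,v) is almost surely the stochastic integral of the truncated expansion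
`lowApprox`. Everything rests on the increment from J to J + 1, which on level j is a block of
indices k between about K = 2^{J-|j|} and 2K.

For x ≥ 1, θ(x, v) is a second difference of the primitive of t^κ. Hence the coefficients on the
block are O(K^{κ-1} min(1, 2^j/K)), and consecutive ones differ by a further factor 1/K
(`abs_theta_sub_theta_le`, `abs_theta_sub_theta_diff_le`).

Pathwise, a sum of n of the ζ_{j,-k} on one level is SαS with scale at most n^{1/α}. Borel-Cantelli
over all dyadic blocks of indices bounds the partial sums by C (1+|j|)^{1/α+ε} n^{1/α+ε}
(`ae_exists_sum_zeta_le`). Summation by parts then bounds level j by a constant times (1+J)^{1/α+ε}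
2^{-jv} K^{v-1+ε} min(1, 2^j/K). The sum over j is O((1+J)^{1/α+ε} 2^{-J(1-v)}): negative levels
decay geometrically in J - |j|, the others geometrically in j because v > 1/2
(`exists_sum_level_weight_le`). So the sums are Cauchy in the supremum norm, with the stated rate.

To identify the limit, the same level estimate with ε = 0 shows that `lowApprox` is Cauchy in L^α.
Its pointwise limit is the kernel, because the expansion telescopes into dyadic averages of the
kernel (`kernelMean_succ_sub`). Convergence of the integrands in L^α then gives the stochastic
integral (`hasStableIntegral_of_tendsto`) and, applied to linear combinations, the SαS law
(`isSymStable_of_tendsto`). -/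

namespace HaarLMSM

/-! ### Integrals of simple functions against a stable random measure. -/

section StochasticIntegral

variable {Ω : Type*} [MeasurableSpace Ω] {P : Measure Ω} {α : ℝ} {Z : Set ℝ → Ω → ℝ}

theorem IsStableRandomMeasure.empty_ae_eq (hZ : IsStableRandomMeasure P α Z) :
    ∀ᵐ ω ∂P, Z ∅ ω = 0 := by
  filter_upwards [hZ.sigma_additive (fun _ => ∅) (fun _ => MeasurableSet.empty) (by simp)
    (fun _ _ _ => disjoint_bot_left)] with ω hω
  have h1 := (hω.comp (tendsto_add_atTop_nat 1)).sub hω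
  simp only [Function.comp_def, Finset.sum_range_succ, add_sub_cancel_left, sub_self] at h1
  exact tendsto_nhds_unique tendsto_const_nhds h1

theorem IsStableRandomMeasure.union_ae_eq (hZ : IsStableRandomMeasure P α Z) {A B : Set ℝ}
    (hA : MeasurableSet A) (hB : MeasurableSet B) (hA' : volume A ≠ ⊤) (hB' : volume B ≠ ⊤)
    (hAB : Disjoint A B) : ∀ᵐ ω ∂P, Z (A ∪ B) ω = Z A ω + Z B ω := by
  let C : ℕ → Set ℝ := fun n => if n = 0 then A else if n = 1 then B else ∅
  have hC : ⋃ i, C i = A ∪ B := by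
    ext x
    simp only [mem_iUnion, mem_union]
    constructor
    · rintro ⟨i, hi⟩
      simp only [C] at hi
      split_ifs at hi
      · exact Or.inl hi
      · exact Or.inr hi
      · exact hi.elim
    · rintro (h | h)
      · exact ⟨0, by simpa [C] using h⟩
      · exact ⟨1, by simpa [C] using h⟩
  have hCm : ∀ i, MeasurableSet (C i) := by
    intro i
    simp only [C]
    split_ifs <;> simp [hA, hB]
  have hCd : Pairwise (fun i j => Disjoint (C i) (C j)) := by
    intro i j hij
    simp only [C]
    split_ifs <;> first | omega | simp [hAB.symm]
  filter_upwards [hZ.sigma_additive C hCm (by rw [hC]; exact (measure_union_lt_top hA'.lt_top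
    hB'.lt_top).ne) hCd, hZ.empty_ae_eq] with ω hω h0
  rw [hC] at hω
  refine tendsto_nhds_unique hω (tendsto_const_nhds.congr' ?_)
  filter_upwards [eventually_ge_atTop 2] with n hn
  obtain ⟨m, rfl⟩ := Nat.exists_eq_add_of_le hn
  rw [Finset.sum_range_add, Finset.sum_eq_zero (s := Finset.range m)]
  · simp [Finset.sum_range_succ, C]
  · intro i _
    simp only [C]
    rw [if_neg (by omega), if_neg (by omega), h0]

theorem IsStableRandomMeasure.biUnion_ae_eq (hZ : IsStableRandomMeasure P α Z) {ι : Type*}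
    (s : Finset ι) {A : ι → Set ℝ} (hA : ∀ i ∈ s, MeasurableSet (A i))
    (hA' : ∀ i ∈ s, volume (A i) ≠ ⊤) (hd : (s : Set ι).PairwiseDisjoint A) :
    ∀ᵐ ω ∂P, Z (⋃ i ∈ s, A i) ω = ∑ i ∈ s, Z (A i) ω := by
  classical
  induction s using Finset.induction_on with
  | empty => simpa using hZ.empty_ae_eq
  | insert i s his ih =>
    simp only [Finset.mem_insert, forall_eq_or_imp] at hA hA'
    rw [Finset.coe_insert, pairwiseDisjoint_insert_of_notMem (by simpa using his)] at hd
    have hU : volume (⋃ i ∈ s, A i) ≠ ⊤ :=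
      (measure_biUnion_lt_top s.finite_toSet fun j hj => (hA'.2 j hj).lt_top).ne
    filter_upwards [ih hA.2 hA'.2 hd.1, hZ.union_ae_eq hA.1 (Finset.measurableSet_biUnion s hA.2)
      hA'.1 hU (disjoint_iUnion₂_right.2 fun j hj => hd.2 j hj)] with ω h1 h2
    rw [Finset.set_biUnion_insert, h2, Finset.sum_insert his, h1]

/-- Allows an integral to be computed on a partition finer than the level sets. With the pair (f, g)
as `q`, it puts f, g and f + g on one partition, where additivity is plain. Fibres with φ = 0 may
have infinite measure. -/
theorem simpleIntegral_map_ae_eq (hZ : IsStableRandomMeasure P α Z) {β : Type*}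
    (q : SimpleFunc ℝ β) (φ : β → ℝ) (hq : ∀ b, φ b ≠ 0 → volume (q ⁻¹' {b}) ≠ ⊤) :
    ∀ᵐ ω ∂P, simpleIntegral Z (q.map φ) ω = ∑ b ∈ q.range, φ b * Z (q ⁻¹' {b}) ω := by
  classical
  have key : ∀ c ∈ (q.map φ).range, ∀ᵐ ω ∂P, c * Z ((q.map φ) ⁻¹' {c}) ω
      = ∑ b ∈ q.range with φ b = c, φ b * Z (q ⁻¹' {b}) ω := by
    intro c _
    by_cases hc : c = 0
    · refine Eventually.of_forall fun ω => ?_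
      rw [hc, zero_mul, Finset.sum_eq_zero]
      intro b hb
      rw [(Finset.mem_filter.1 hb).2, zero_mul]
    · have hpre : (q.map φ) ⁻¹' {c} = ⋃ b ∈ q.range.filter (fun b => φ b = c), q ⁻¹' {b} := by
        rw [SimpleFunc.map_preimage_singleton]
        ext x
        simp
      filter_upwards [hZ.biUnion_ae_eq (q.range.filter fun b => φ b = c)
        (A := fun b => q ⁻¹' {b}) (fun b _ => q.measurableSet_fiber b)
        (fun b hb => hq b (by rw [(Finset.mem_filter.1 hb).2]; exact hc))
        (fun b _ b' _ hbb => Disjoint.preimage _ (by simpa using hbb))] with ω hω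
      rw [hpre, hω, Finset.mul_sum]
      exact Finset.sum_congr rfl fun b hb => by rw [(Finset.mem_filter.1 hb).2]
  filter_upwards [(Finset.eventually_all _).2 key] with ω hω
  rw [simpleIntegral, Finset.sum_congr rfl hω]
  exact Finset.sum_fiberwise_of_maps_to
    (fun b hb => by rw [SimpleFunc.range_map]; exact Finset.mem_image_of_mem _ hb) _

theorem simpleIntegral_add_ae_eq (hZ : IsStableRandomMeasure P α Z) {f g : SimpleFunc ℝ ℝ}
    (hf : f.FinMeasSupp volume) (hg : g.FinMeasSupp volume) :
    ∀ᵐ ω ∂P, simpleIntegral Z (f + g) ω = simpleIntegral Z f ω + simpleIntegral Z g ω := by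
  have hp := SimpleFunc.finMeasSupp_iff.1 (hf.pair hg)
  have h1 := simpleIntegral_map_ae_eq hZ (f.pair g) Prod.fst
    (fun b hb => (hp b fun h => hb (by simp [h])).ne)
  have h2 := simpleIntegral_map_ae_eq hZ (f.pair g) Prod.snd
    (fun b hb => (hp b fun h => hb (by simp [h])).ne)
  have h3 := simpleIntegral_map_ae_eq hZ (f.pair g) (fun p => p.1 + p.2)
    (fun b hb => (hp b fun h => hb (by simp [h])).ne)
  filter_upwards [h1, h2, h3] with ω h1 h2 h3
  rw [SimpleFunc.map_fst_pair] at h1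
  rw [SimpleFunc.map_snd_pair] at h2
  rw [SimpleFunc.add_eq_map₂, h1, h2, h3, ← Finset.sum_add_distrib]
  exact Finset.sum_congr rfl fun b _ => add_mul _ _ _

theorem simpleIntegral_smul_ae_eq (hZ : IsStableRandomMeasure P α Z) (c : ℝ) {f : SimpleFunc ℝ ℝ}
    (hf : f.FinMeasSupp volume) :
    ∀ᵐ ω ∂P, simpleIntegral Z (c • f) ω = c * simpleIntegral Z f ω := by
  have hp := SimpleFunc.finMeasSupp_iff.1 hf
  filter_upwards [simpleIntegral_map_ae_eq hZ f (fun x => c * x)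
    (fun b hb => (hp b fun h => hb (by simp [h])).ne)] with ω h
  rw [SimpleFunc.smul_eq_map]
  simp only [smul_eq_mul]
  rw [h, simpleIntegral, Finset.mul_sum]
  exact Finset.sum_congr rfl fun b _ => mul_assoc _ _ _

theorem finMeasSupp_smul (c : ℝ) {f : SimpleFunc ℝ ℝ} (hf : f.FinMeasSupp volume) :
    (c • f).FinMeasSupp volume := by
  rw [SimpleFunc.smul_eq_map]
  exact hf.map (by simp)

theorem finMeasSupp_zero : (0 : SimpleFunc ℝ ℝ).FinMeasSupp volume := by
  rw [SimpleFunc.finMeasSupp_iff_support]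
  simp

theorem finMeasSupp_sum {ι : Type*} (s : Finset ι) {f : ι → SimpleFunc ℝ ℝ}
    (hf : ∀ i ∈ s, (f i).FinMeasSupp volume) : (∑ i ∈ s, f i).FinMeasSupp volume :=
  Finset.sum_induction f (fun g => g.FinMeasSupp volume) (fun _ _ h1 h2 => h1.add h2)
    finMeasSupp_zero hf

theorem simpleIntegral_zero {Ω : Type*} (Z : Set ℝ → Ω → ℝ) (ω : Ω) : simpleIntegral Z 0 ω = 0 := by
  refine Finset.sum_eq_zero fun c hc => ?_
  obtain ⟨x, rfl⟩ := SimpleFunc.mem_range.1 hc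
  simp

theorem simpleIntegral_sum_ae_eq (hZ : IsStableRandomMeasure P α Z) {ι : Type*} (s : Finset ι)
    {f : ι → SimpleFunc ℝ ℝ} (hf : ∀ i ∈ s, (f i).FinMeasSupp volume) :
    ∀ᵐ ω ∂P, simpleIntegral Z (∑ i ∈ s, f i) ω = ∑ i ∈ s, simpleIntegral Z (f i) ω := by
  classical
  induction s using Finset.induction_on with
  | empty => simp [simpleIntegral_zero]
  | insert i s his ih =>
    simp only [Finset.mem_insert, forall_eq_or_imp] at hf
    filter_upwards [ih hf.2, simpleIntegral_add_ae_eq hZ hf.1 (finMeasSupp_sum s hf.2)]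
      with ω h1 h2
    rw [Finset.sum_insert his, Finset.sum_insert his, h2, h1]

theorem simpleIntegral_sub_ae_eq (hZ : IsStableRandomMeasure P α Z) {f g : SimpleFunc ℝ ℝ}
    (hf : f.FinMeasSupp volume) (hg : g.FinMeasSupp volume) :
    ∀ᵐ ω ∂P, simpleIntegral Z (f - g) ω = simpleIntegral Z f ω - simpleIntegral Z g ω := by
  filter_upwards [simpleIntegral_add_ae_eq hZ hf (finMeasSupp_smul (-1) hg),
    simpleIntegral_smul_ae_eq hZ (-1) hg] with ω h1 h2
  have : f - g = f + (-1 : ℝ) • g := by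
    ext x
    simp [sub_eq_add_neg]
  rw [this, h1, h2]
  ring

/-- The fibre over 0 may have infinite measure, where nothing is known about `Z`. It has to go
before measurability or independence can be used. -/
theorem simpleIntegral_eq_sum_filter {Ω : Type*} {Z : Set ℝ → Ω → ℝ} (f : SimpleFunc ℝ ℝ)
    (ω : Ω) :
    simpleIntegral Z f ω = ∑ c ∈ f.range.filter (· ≠ 0), c * Z (f ⁻¹' {c}) ω := by
  rw [simpleIntegral, Finset.sum_filter_of_ne]
  intro c _ h hc
  simp [hc] at h

theorem measurable_simpleIntegral (hZ : IsStableRandomMeasure P α Z) {f : SimpleFunc ℝ ℝ}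
    (hf : f.FinMeasSupp volume) : Measurable (simpleIntegral Z f) := by
  have : simpleIntegral Z f = fun ω => ∑ c ∈ f.range.filter (· ≠ 0), c * Z (f ⁻¹' {c}) ω :=
    funext fun ω => simpleIntegral_eq_sum_filter f ω
  rw [this]
  refine Finset.measurable_sum _ fun c hc =>
    (hZ.measurable _ (f.measurableSet_fiber c) ?_).const_mul c
  exact (SimpleFunc.finMeasSupp_iff.1 hf c (Finset.mem_filter.1 hc).2).ne

theorem IsSymStable.congr_ae {σ : ℝ} {X Y : Ω → ℝ} (hX : IsSymStable P α σ X) (h : X =ᵐ[P] Y) :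
    IsSymStable P α σ Y := fun t => by rw [← Measure.map_congr h, hX t]

/-- The fibres over nonzero values are disjoint and of finite measure, so independence multiplies
the characteristic functions, and the exponents add up to |t|^α ∑ |c|^α |{f = c}|. -/
theorem isSymStable_simpleIntegral (hZ : IsStableRandomMeasure P α Z) (hα : 0 < α)
    {f : SimpleFunc ℝ ℝ} (hf : f.FinMeasSupp volume) :
    IsSymStable P α (eLpNorm f (ENNReal.ofReal α) volume).toReal (simpleIntegral Z f) := by
  intro t
  set s := f.range.filter (· ≠ 0) with hs
  have hfin : ∀ c ∈ s, volume (f ⁻¹' {c}) ≠ ⊤ := fun c hc =>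
    (SimpleFunc.finMeasSupp_iff.1 hf c (Finset.mem_filter.1 hc).2).ne
  have hm : ∀ c ∈ s, Measurable (Z (f ⁻¹' {c})) := fun c hc =>
    hZ.measurable _ (f.measurableSet_fiber c) (hfin c hc)
  have hind : iIndepFun (fun c : s => Z (f ⁻¹' {(c : ℝ)})) P := by
    have := hZ.independent s.card (fun i => f ⁻¹' {((s.equivFin.symm i : s) : ℝ)})
      (fun i => f.measurableSet_fiber _) (fun i => hfin _ (s.equivFin.symm i).2)
      (fun i j hij => Disjoint.preimage _ (by
        simpa [Subtype.coe_inj] using hij))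
    have h2 := this.precomp (g := s.equivFin) s.equivFin.injective
    simpa using h2
  have hind2 : iIndepFun (fun c : s => fun ω => (c : ℝ) * Z (f ⁻¹' {(c : ℝ)}) ω) P :=
    hind.comp (fun c x => (c : ℝ) * x) (fun c => measurable_const_mul _)
  have hsum : simpleIntegral Z f = fun ω => ∑ c : s, (c : ℝ) * Z (f ⁻¹' {(c : ℝ)}) ω := by
    funext ω
    rw [simpleIntegral_eq_sum_filter, ← Finset.sum_coe_sort]
  have hnorm : (eLpNorm f (ENNReal.ofReal α) volume).toReal ^ α
      = ∑ c : s, |(c : ℝ)| ^ α * (volume (f ⁻¹' {(c : ℝ)})).toReal := by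
    rw [eLpNorm_eq_eLpNorm' (by simpa using hα) ENNReal.ofReal_ne_top, SimpleFunc.eLpNorm'_eq,
      ENNReal.toReal_ofReal hα.le, ENNReal.toReal_rpow, ← ENNReal.rpow_mul, one_div,
      inv_mul_cancel₀ hα.ne', ENNReal.rpow_one,
      ← Finset.sum_filter_of_ne (s := f.range) (p := (· ≠ 0)), ENNReal.toReal_sum,
      ← Finset.sum_coe_sort]
    · refine Finset.sum_congr rfl fun c _ => ?_
      rw [ENNReal.toReal_mul, ← ENNReal.toReal_rpow]
      simp
    · intro c hc
      exact ENNReal.mul_ne_top (ENNReal.rpow_ne_top_of_nonneg hα.le enorm_ne_top) (hfin c hc)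
    · intro c _ h hc
      simp [hc, hα] at h
  have hprod := hind2.charFun_map_fun_sum_eq_prod
    (fun c : s => ((hm c c.2).const_mul (c : ℝ)).aemeasurable)
  rw [hnorm, hsum, hprod, Finset.prod_apply, Finset.sum_mul]
  push_cast
  rw [← Finset.sum_neg_distrib, Complex.exp_sum]
  refine Finset.prod_congr rfl fun c _ => ?_
  rw [charFun_map_mul_comp (hm c c.2).aemeasurable,
    hZ.symStable _ (f.measurableSet_fiber c) (hfin c c.2), ← Real.rpow_mul ENNReal.toReal_nonneg,
    one_div, inv_mul_cancel₀ hα.ne', Real.rpow_one, abs_mul,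
    Real.mul_rpow (abs_nonneg _) (abs_nonneg _)]
  push_cast
  congr 1
  ring

/-- The integral of 1 - φ over [-2/r, 2/r] controls the tail, and 1 - exp(-x) ≤ x bounds the
integrand there by (2σ/r)^α. -/
theorem IsSymStable.tail_le [IsProbabilityMeasure P] (hα : 0 < α) {σ : ℝ} (hσ : 0 ≤ σ) {X : Ω → ℝ}
    (hXm : AEMeasurable X P) (hX : IsSymStable P α σ X) {r : ℝ} (hr : 0 < r) :
    P.real {ω | r < |X ω|} ≤ 2 * (2 * σ / r) ^ α := by
  have : IsProbabilityMeasure (P.map X) := Measure.isProbabilityMeasure_map hXm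
  have h1 := measureReal_abs_gt_le_integral_charFun (μ := P.map X) hr
  rw [map_measureReal_apply_of_aemeasurable hXm (measurableSet_lt measurable_const (by fun_prop))]
    at h1
  refine h1.trans ?_
  have hb : ∀ t ∈ uIoc (-2 * r⁻¹) (2 * r⁻¹), ‖1 - charFun (P.map X) t‖ ≤ (2 * σ / r) ^ α := by
    intro t ht
    have ht' : |t| ≤ 2 * r⁻¹ := by
      rw [uIoc_of_le (by nlinarith [inv_pos.2 hr])] at ht
      exact abs_le.2 ⟨by linarith [ht.1], ht.2⟩
    have hx : 0 ≤ σ ^ α * |t| ^ α := by positivity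
    rw [hX t, ← Complex.ofReal_neg, ← Complex.ofReal_exp, ← Complex.ofReal_one,
      ← Complex.ofReal_sub, Complex.norm_real, Real.norm_eq_abs, abs_of_nonneg
        (by simpa using hx)]
    calc 1 - Real.exp (-(σ ^ α * |t| ^ α)) ≤ σ ^ α * |t| ^ α := by
          linarith [Real.add_one_le_exp (-(σ ^ α * |t| ^ α))]
      _ = (σ * |t|) ^ α := (Real.mul_rpow hσ (abs_nonneg _)).symm
      _ ≤ (2 * σ / r) ^ α := by
          refine Real.rpow_le_rpow (by positivity) ?_ hα.le
          calc σ * |t| ≤ σ * (2 * r⁻¹) := by gcongr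
            _ = 2 * σ / r := by field_simp
  have h2 := intervalIntegral.norm_integral_le_of_norm_le_const hb
  calc 2⁻¹ * r * ‖∫ t in (-2 * r⁻¹)..(2 * r⁻¹), 1 - charFun (P.map X) t‖
      ≤ 2⁻¹ * r * ((2 * σ / r) ^ α * |2 * r⁻¹ - -2 * r⁻¹|) := by gcongr
    _ = 2 * (2 * σ / r) ^ α := by
      rw [show 2 * r⁻¹ - -2 * r⁻¹ = 4 * r⁻¹ by ring, abs_of_pos (by positivity)]
      field_simp
      ring

theorem tendsto_toReal_eLpNorm_of_tendsto_sub (hα : 1 ≤ α) {F : ℝ → ℝ}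
    (hF : MemLp F (ENNReal.ofReal α) volume) {G : ℕ → SimpleFunc ℝ ℝ}
    (hG : ∀ n, MemLp (G n) (ENNReal.ofReal α) volume)
    (hlim : Tendsto (fun n => eLpNorm (fun s => G n s - F s) (ENNReal.ofReal α) volume) atTop
      (𝓝 0)) :
    Tendsto (fun n => (eLpNorm (G n) (ENNReal.ofReal α) volume).toReal) atTop
      (𝓝 (eLpNorm F (ENNReal.ofReal α) volume).toReal) := by
  have hp : 1 ≤ ENNReal.ofReal α := by simpa using hα
  have hlim' : Tendsto (fun n => (eLpNorm (fun s => G n s - F s) (ENNReal.ofReal α)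
      volume).toReal) atTop (𝓝 0) := by
    simpa [Function.comp_def] using (ENNReal.tendsto_toReal ENNReal.zero_ne_top).comp hlim
  rw [tendsto_iff_dist_tendsto_zero]
  refine squeeze_zero (fun _ => dist_nonneg) (fun n => ?_) hlim'
  have hsub : MemLp (fun s => G n s - F s) (ENNReal.ofReal α) volume := (hG n).sub hF
  have e1 := eLpNorm_add_le hsub.1 hF.1 hp
  have e2 := eLpNorm_sub_le (hG n).1 hsub.1 hp
  have s1 : (fun s => G n s - F s) + F = ⇑(G n) := by ext s; simp
  have s2 : (⇑(G n) - fun s => G n s - F s) = F := by ext s; simp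
  rw [s1] at e1
  rw [s2] at e2
  have r1 := ENNReal.toReal_mono (ENNReal.add_ne_top.2 ⟨hsub.2.ne, hF.2.ne⟩) e1
  have r2 := ENNReal.toReal_mono (ENNReal.add_ne_top.2 ⟨(hG n).2.ne, hsub.2.ne⟩) e2
  rw [ENNReal.toReal_add hsub.2.ne hF.2.ne] at r1
  rw [ENNReal.toReal_add (hG n).2.ne hsub.2.ne] at r2
  rw [Real.dist_eq, abs_le]
  constructor <;> linarith

/-- Characteristic functions converge by dominated convergence, and the explicit formula is
continuous in the scale. -/
theorem isSymStable_of_tendsto [IsProbabilityMeasure P] (hα : 0 < α) {σ : ℕ → ℝ} {τ : ℝ}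
    (hσ : Tendsto σ atTop (𝓝 τ)) {X : ℕ → Ω → ℝ} {Y : Ω → ℝ} (hXm : ∀ n, AEMeasurable (X n) P)
    (hX : ∀ n, IsSymStable P α (σ n) (X n))
    (hlim : ∀ᵐ ω ∂P, Tendsto (fun n => X n ω) atTop (𝓝 (Y ω))) : IsSymStable P α τ Y := by
  intro t
  have hYm : AEMeasurable Y P := aemeasurable_of_tendsto_metrizable_ae _ hXm hlim
  have h1 : Tendsto (fun n => charFun (P.map (X n)) t) atTop (𝓝 (charFun (P.map Y) t)) := by
    have hint : ∀ {V : Ω → ℝ}, AEMeasurable V P →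
        charFun (P.map V) t = ∫ ω, Complex.exp (t * V ω * Complex.I) ∂P := by
      intro V hV
      rw [charFun_apply_real, integral_map hV (by fun_prop)]
    rw [hint hYm]
    simp only [fun n => hint (hXm n)]
    refine tendsto_integral_of_dominated_convergence (fun _ => 1) (fun n => ?_)
      (integrable_const _) (fun n => ?_) ?_
    · have := hXm n
      exact AEMeasurable.aestronglyMeasurable (by fun_prop)
    · refine Eventually.of_forall fun ω => ?_
      rw [← Complex.ofReal_mul, Complex.norm_exp_ofReal_mul_I]
    · filter_upwards [hlim] with ω hω
      exact (Complex.continuous_exp.tendsto _).comp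
        (((Complex.continuous_ofReal.tendsto _).comp hω).const_mul _ |>.mul_const _)
  refine tendsto_nhds_unique h1 ?_
  simp only [fun n => hX n t]
  refine (Complex.continuous_exp.tendsto _).comp (Tendsto.neg ?_)
  exact (Complex.continuous_ofReal.tendsto _).comp
    ((hσ.rpow_const (Or.inr hα.le)).mul_const _)

theorem tendstoInMeasure_zero_simpleIntegral [IsProbabilityMeasure P]
    (hZ : IsStableRandomMeasure P α Z) (hα : 0 < α) {G : ℕ → SimpleFunc ℝ ℝ}
    (hG : ∀ n, (G n).FinMeasSupp volume)
    (hlim : Tendsto (fun n => eLpNorm (G n) (ENNReal.ofReal α) volume) atTop (𝓝 0)) :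
    TendstoInMeasure P (fun n => simpleIntegral Z (G n)) atTop (fun _ => (0 : ℝ)) := by
  have hlim' : Tendsto (fun n => (eLpNorm (G n) (ENNReal.ofReal α) volume).toReal) atTop
      (𝓝 0) := by
    simpa [Function.comp_def] using (ENNReal.tendsto_toReal ENNReal.zero_ne_top).comp hlim
  rw [tendstoInMeasure_iff_measureReal_norm]
  intro ε hε
  -- The tail bound concerns a strict inequality, hence the level ε / 2 in place of ε.
  have hb : Tendsto (fun n => 2 * (2 * (eLpNorm (G n) (ENNReal.ofReal α) volume).toReal
      / (ε / 2)) ^ α) atTop (𝓝 0) := by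
    have := (((hlim'.const_mul 2).div_const (ε / 2)).rpow_const (p := α) (Or.inr hα.le)).const_mul 2
    simpa [Real.zero_rpow hα.ne'] using this
  refine squeeze_zero (fun _ => measureReal_nonneg) (fun n => ?_) hb
  refine (measureReal_mono fun ω hω => ?_).trans
    ((isSymStable_simpleIntegral hZ hα (hG n)).tail_le hα
    ENNReal.toReal_nonneg (measurable_simpleIntegral hZ (hG n)).aemeasurable (half_pos hε))
  simp only [sub_zero, Real.norm_eq_abs, mem_ofPred_eq] at hω ⊢
  linarith

theorem memLp_of_tendsto_simpleFunc {F : ℝ → ℝ} (hF : AEStronglyMeasurable F volume)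
    {G : ℕ → SimpleFunc ℝ ℝ} (hG : ∀ n, MemLp (G n) (ENNReal.ofReal α) volume)
    (hlim : Tendsto (fun n => eLpNorm (fun s => G n s - F s) (ENNReal.ofReal α) volume) atTop
      (𝓝 0)) : MemLp F (ENNReal.ofReal α) volume := by
  obtain ⟨n, hn⟩ := (hlim.eventually_lt_const (show (0 : ENNReal) < 1 by simp)).exists
  have hsub : MemLp (fun s => G n s - F s) (ENNReal.ofReal α) volume :=
    ⟨(hG n).1.sub hF, hn.trans ENNReal.one_lt_top⟩
  have := (hG n).sub hsub
  have s2 : (⇑(G n) - fun s => G n s - F s) = F := by ext s; simp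
  rwa [s2] at this

/-- One good approximating sequence suffices: any other differs from it by simple functions tending
to 0 in L^α, whose integrals tend to 0 in probability by the tail bound. -/
theorem hasStableIntegral_of_tendsto [IsProbabilityMeasure P] (hZ : IsStableRandomMeasure P α Z)
    (hα : 1 ≤ α) {F : ℝ → ℝ} (hF : AEStronglyMeasurable F volume) {G : ℕ → SimpleFunc ℝ ℝ}
    (hG : ∀ n, (G n).FinMeasSupp volume)
    (hlim : Tendsto (fun n => eLpNorm (fun s => G n s - F s) (ENNReal.ofReal α) volume) atTop
      (𝓝 0)) {Y : Ω → ℝ}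
    (hY : ∀ᵐ ω ∂P, Tendsto (fun n => simpleIntegral Z (G n) ω) atTop (𝓝 (Y ω))) :
    HasStableIntegral P α Z F Y := by
  have hα0 : 0 < α := by linarith
  have hp0 : ENNReal.ofReal α ≠ 0 := by simpa using hα0
  have hiff : ∀ f : SimpleFunc ℝ ℝ, MemLp f (ENNReal.ofReal α) volume ↔ f.FinMeasSupp volume :=
    fun f => SimpleFunc.memLp_iff_finMeasSupp hp0 ENNReal.ofReal_ne_top
  have hGm := fun n => (hiff _).2 (hG n)
  have hFm := memLp_of_tendsto_simpleFunc hF hGm hlim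
  refine ⟨hFm, fun g hg hglim => ?_⟩
  have hg' := fun n => (hiff _).1 (hg n)
  have hsub : ∀ n, (g n - G n).FinMeasSupp volume := fun n => by
    rw [← hiff, SimpleFunc.coe_sub]
    exact (hg n).sub (hGm n)
  have h0 : Tendsto (fun n => eLpNorm (g n - G n) (ENNReal.ofReal α) volume) atTop (𝓝 0) := by
    refine tendsto_of_tendsto_of_tendsto_of_le_of_le tendsto_const_nhds
      (by simpa using hglim.add hlim) (fun _ => zero_le) (fun n => ?_)
    have := eLpNorm_sub_le ((hg n).sub hFm).1 ((hGm n).sub hFm).1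
      (show 1 ≤ ENNReal.ofReal α by simpa using hα)
    rw [sub_sub_sub_cancel_right] at this
    exact this
  have h1 := tendstoInMeasure_zero_simpleIntegral hZ hα0 hsub h0
  have h2 := tendstoInMeasure_of_tendsto_ae (μ := P)
    (fun n => (measurable_simpleIntegral hZ (hG n)).aestronglyMeasurable) hY
  rw [tendstoInMeasure_iff_measureReal_norm] at h1 h2 ⊢
  intro ε hε
  refine squeeze_zero (fun _ => measureReal_nonneg) (fun n => ?_)
    (by simpa using (h1 (ε / 2) (half_pos hε)).add (h2 (ε / 2) (half_pos hε)))
  refine le_trans ?_ (measureReal_union_le _ _)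
  refine ENNReal.toReal_mono (measure_ne_top _ _) (measure_mono_ae ?_)
  filter_upwards [simpleIntegral_sub_ae_eq hZ (hg' n) (hG n)] with ω hω h
  by_contra hcon
  have hcon' := not_or.1 hcon
  have hd1 : |simpleIntegral Z (g n - G n) ω| < ε / 2 := by simpa using hcon'.1
  have hd2 : |simpleIntegral Z (G n) ω - Y ω| < ε / 2 := by simpa using hcon'.2
  have hd3 : ε ≤ |simpleIntegral Z (g n) ω - Y ω| := h
  rw [hω] at hd1
  have := abs_sub_le (simpleIntegral Z (g n) ω) (simpleIntegral Z (G n) ω) (Y ω)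
  linarith

end StochasticIntegral

/-! ### The function θ as a second difference. -/

/-- The primitive `x ^ (κ + 1) / (κ + 1)` of `x ^ κ` on `[0, ∞)`. -/
noncomputable def powPrim (κ x : ℝ) : ℝ := x ^ (κ + 1) / (κ + 1)

theorem integral_sub_left_rpow {κ : ℝ} (hκ : 0 < κ) (x a b : ℝ) :
    ∫ s in a..b, (x - s) ^ κ = powPrim κ (x - a) - powPrim κ (x - b) := by
  rw [intervalIntegral.integral_comp_sub_left (fun s => s ^ κ) x,
    integral_rpow (Or.inl (by linarith)), powPrim, powPrim, sub_div]

theorem setIntegral_posPow_sub {κ x a b : ℝ} (hκ : 0 < κ) (hab : a ≤ b) (hbx : b ≤ x) :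
    ∫ s in Ico a b, posPow (x - s) κ = powPrim κ (x - a) - powPrim κ (x - b) := by
  rw [← integral_sub_left_rpow hκ, intervalIntegral.integral_of_le hab,
    ← integral_Ico_eq_integral_Ioc]
  refine setIntegral_congr_fun measurableSet_Ico fun s hs => ?_
  simp only [posPow]
  rw [if_pos (by linarith [hs.2])]

theorem integrableOn_posPow_sub {κ x a b : ℝ} (hκ : 0 < κ) (hbx : b ≤ x) :
    IntegrableOn (fun s => posPow (x - s) κ) (Ico a b) := by
  have hc : Continuous fun s : ℝ => (x - s) ^ κ :=
    (continuous_const.sub continuous_id).rpow_const fun _ => Or.inr hκ.le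
  have h1 : IntegrableOn (fun s : ℝ => (x - s) ^ κ) (Ico a b) :=
    (hc.continuousOn.integrableOn_compact isCompact_Icc).mono_set Ico_subset_Icc_self
  refine h1.congr_fun (fun s hs => ?_) measurableSet_Ico
  simp only [posPow]
  rw [if_pos (by linarith [hs.2])]

/-- For x ≥ 1 the positive part is inactive on the support of h, and the two halves of h contribute
increments of one primitive. -/
theorem theta_eq_powPrim {α x v : ℝ} (hv : 1 / α < v) (hx : 1 ≤ x) :
    theta α x v = powPrim (v - 1 / α) x - 2 * powPrim (v - 1 / α) (x - 1 / 2)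
      + powPrim (v - 1 / α) (x - 1) := by
  have hκ : 0 < v - 1 / α := by linarith
  have h : ∀ s : ℝ, posPow (x - s) (v - 1 / α) * haar s
      = (Ico (0 : ℝ) (1 / 2)).indicator (fun s => posPow (x - s) (v - 1 / α)) s
        - (Ico (1 / 2 : ℝ) 1).indicator (fun s => posPow (x - s) (v - 1 / α)) s := by
    intro s
    rw [haar_apply, mul_sub]
    congr 1 <;> simp [indicator_apply]
  rw [theta]
  simp only [h]
  rw [integral_sub ((integrable_indicator_iff measurableSet_Ico).2
      (integrableOn_posPow_sub hκ (by linarith)))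
      ((integrable_indicator_iff measurableSet_Ico).2 (integrableOn_posPow_sub hκ hx)),
    integral_indicator measurableSet_Ico, integral_indicator measurableSet_Ico,
    setIntegral_posPow_sub hκ (by norm_num) (by linarith),
    setIntegral_posPow_sub hκ (by norm_num) hx, sub_zero]
  ring

/-- The exponent p.1 + 1 is positive, so joint continuity persists at base 0; this is needed for θ
at x = 1. -/
theorem continuousOn_powPrim {s : Set (ℝ × ℝ)} (hs : ∀ p ∈ s, 0 < p.1) :
    ContinuousOn (fun p : ℝ × ℝ => powPrim p.1 p.2) s := by
  intro p hp
  refine ContinuousAt.continuousWithinAt ?_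
  have h0 := hs p hp
  unfold powPrim
  refine ContinuousAt.div ?_ (by fun_prop) (by linarith)
  exact ContinuousAt.rpow (by fun_prop) (by fun_prop) (Or.inr (by linarith))

/-! ### Finite differences -/

/-- The forward difference of `f` with step `h`. -/
def fdiff (h : ℝ) (f : ℝ → ℝ) (y : ℝ) : ℝ := f (y + h) - f y

theorem hasDerivAt_fdiff {f f' : ℝ → ℝ} {x h : ℝ} (hh : 0 ≤ h)
    (hf : ∀ y, x ≤ y → HasDerivAt f (f' y) y) (y : ℝ) (hy : x ≤ y) :
    HasDerivAt (fdiff h f) (fdiff h f' y) y :=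
  ((hf (y + h) (by linarith)).comp_add_const y h).sub (hf y hy)

theorem abs_fdiff_le {f f' : ℝ → ℝ} {x h M : ℝ} (hh : 0 ≤ h)
    (hf : ∀ y, x ≤ y → HasDerivAt f (f' y) y) (hM : ∀ y, x ≤ y → |f' y| ≤ M) (y : ℝ)
    (hy : x ≤ y) : |fdiff h f y| ≤ M * h := by
  have := Convex.norm_image_sub_le_of_norm_hasDerivWithin_le (s := Ici x) (C := M)
    (fun z hz => (hf z hz).hasDerivWithinAt) (fun z hz => hM z hz) (convex_Ici x)
    (show y ∈ Ici x from hy) (show y + h ∈ Ici x from by simp only [mem_Ici]; linarith)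
  simpa [fdiff, abs_of_nonneg hh] using this

theorem abs_fdiff_le_two_mul {f : ℝ → ℝ} {x h M : ℝ} (hh : 0 ≤ h)
    (hM : ∀ y, x ≤ y → |f y| ≤ M) (y : ℝ) (hy : x ≤ y) : |fdiff h f y| ≤ 2 * M := by
  have h1 := hM y hy
  have h2 := hM (y + h) (by linarith)
  have := abs_sub (f (y + h)) (f y)
  simp only [fdiff]
  linarith

/-- The second difference with step `1 / 2`. -/
noncomputable def fdiffHalf (f : ℝ → ℝ) : ℝ → ℝ := fdiff (1 / 2) (fdiff (1 / 2) f)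

theorem hasDerivAt_fdiffHalf {f f' : ℝ → ℝ} {x : ℝ}
    (hf : ∀ y, x ≤ y → HasDerivAt f (f' y) y) (y : ℝ) (hy : x ≤ y) :
    HasDerivAt (fdiffHalf f) (fdiffHalf f' y) y :=
  hasDerivAt_fdiff (by norm_num) (hasDerivAt_fdiff (by norm_num) hf) y hy

theorem abs_fdiffHalf_le {f f' f'' : ℝ → ℝ} {x M : ℝ}
    (hf : ∀ y, x ≤ y → HasDerivAt f (f' y) y) (hf' : ∀ y, x ≤ y → HasDerivAt f' (f'' y) y)
    (hM : ∀ y, x ≤ y → |f'' y| ≤ M) (y : ℝ) (hy : x ≤ y) : |fdiffHalf f y| ≤ M / 4 := by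
  have := abs_fdiff_le (h := 1 / 2) (by norm_num) (hasDerivAt_fdiff (h := 1 / 2) (by norm_num) hf)
    (abs_fdiff_le (h := 1 / 2) (by norm_num) hf' hM) y hy
  calc |fdiffHalf f y| ≤ M * (1 / 2) * (1 / 2) := this
    _ = M / 4 := by ring

/-! ### Bounds for second differences of powers. -/

section PowerDerivatives

variable {κ : ℝ}

theorem hasDerivAt_powPrim (hκ : 0 < κ) (y : ℝ) : HasDerivAt (powPrim κ) (y ^ κ) y := by
  have := (Real.hasDerivAt_rpow_const (x := y) (p := κ + 1)
    (Or.inr (by linarith))).div_const (κ + 1)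
  have hne : κ + 1 ≠ 0 := by linarith
  rw [add_sub_cancel_right, mul_div_cancel_left₀ _ hne] at this
  exact this

theorem hasDerivAt_const_mul_rpow (c p : ℝ) {y : ℝ} (hy : 0 < y) :
    HasDerivAt (fun y : ℝ => c * y ^ p) (c * p * y ^ (p - 1)) y := by
  have := (Real.hasDerivAt_rpow_const (x := y) (p := p) (Or.inl hy.ne')).const_mul c
  rwa [← mul_assoc] at this

theorem abs_const_mul_rpow_le {c C p x y : ℝ} (hc : |c| ≤ C) (hp : p ≤ 0) (hx : 0 < x)
    (hxy : x ≤ y) : |c * y ^ p| ≤ C * x ^ p := by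
  have hy : 0 < y := hx.trans_le hxy
  rw [abs_mul, abs_of_nonneg (Real.rpow_nonneg hy.le p)]
  exact mul_le_mul hc (Real.rpow_le_rpow_of_nonpos hx hxy hp) (Real.rpow_nonneg hy.le p)
    ((abs_nonneg c).trans hc)

theorem hasDerivAt_rpow_first {y : ℝ} (hy : 0 < y) :
    HasDerivAt (fun y : ℝ => y ^ κ) (κ * y ^ (κ - 1)) y := by
  simpa using hasDerivAt_const_mul_rpow 1 κ hy

theorem hasDerivAt_rpow_second {y : ℝ} (hy : 0 < y) :
    HasDerivAt (fun y : ℝ => κ * y ^ (κ - 1)) (κ * (κ - 1) * y ^ (κ - 2)) y := by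
  have := hasDerivAt_const_mul_rpow κ (κ - 1) hy
  rwa [show κ - 1 - 1 = κ - 2 by ring] at this

theorem hasDerivAt_rpow_third {y : ℝ} (hy : 0 < y) :
    HasDerivAt (fun y : ℝ => κ * (κ - 1) * y ^ (κ - 2))
      (κ * (κ - 1) * (κ - 2) * y ^ (κ - 3)) y := by
  have := hasDerivAt_const_mul_rpow (κ * (κ - 1)) (κ - 2) hy
  rwa [show κ - 2 - 1 = κ - 3 by ring] at this

theorem abs_fdiffHalf_powPrim_le (hκ : 0 < κ) (hκ1 : κ < 1) {x : ℝ} (hx : 0 < x) (y : ℝ)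
    (hy : x ≤ y) : |fdiffHalf (powPrim κ) y| ≤ x ^ (κ - 1) / 4 := by
  refine abs_fdiffHalf_le (fun y _ => hasDerivAt_powPrim hκ y)
    (fun y hy => hasDerivAt_rpow_first (hx.trans_le hy)) (fun y hy => ?_) y hy
  simpa using abs_const_mul_rpow_le (C := 1) (by rw [abs_of_pos hκ]; exact hκ1.le)
    (by linarith) hx hy

theorem abs_fdiffHalf_rpow_le (hκ : 0 < κ) (hκ1 : κ < 1) {x : ℝ} (hx : 0 < x) (y : ℝ)
    (hy : x ≤ y) : |fdiffHalf (fun y => y ^ κ) y| ≤ x ^ (κ - 2) / 4 := by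
  refine abs_fdiffHalf_le (fun y hy => hasDerivAt_rpow_first (hx.trans_le hy))
    (fun y hy => hasDerivAt_rpow_second (hx.trans_le hy)) (fun y hy => ?_) y hy
  have hc : |κ * (κ - 1)| ≤ 1 := abs_le.2 ⟨by nlinarith, by nlinarith⟩
  simpa using abs_const_mul_rpow_le hc (by linarith) hx hy

theorem abs_fdiffHalf_deriv_rpow_le (hκ : 0 < κ) (hκ1 : κ < 1) {x : ℝ} (hx : 0 < x) (y : ℝ)
    (hy : x ≤ y) : |fdiffHalf (fun y => κ * y ^ (κ - 1)) y| ≤ 2 * x ^ (κ - 3) / 4 := by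
  refine abs_fdiffHalf_le (fun y hy => hasDerivAt_rpow_second (hx.trans_le hy))
    (fun y hy => hasDerivAt_rpow_third (hx.trans_le hy)) (fun y hy => ?_) y hy
  have hc : |κ * (κ - 1) * (κ - 2)| ≤ 2 := by
    have h1 : |κ * (κ - 1)| ≤ 1 := abs_le.2 ⟨by nlinarith, by nlinarith⟩
    have h2 : |κ - 2| ≤ 2 := abs_le.2 ⟨by linarith, by linarith⟩
    rw [abs_mul]
    nlinarith [abs_nonneg (κ * (κ - 1)), abs_nonneg (κ - 2)]
  exact abs_const_mul_rpow_le hc (by linarith) hx hy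

/-- Subadditivity of t^κ replaces the derivative bound, which fails near 0 because κ y^{κ-1} is
unbounded there. -/
theorem abs_fdiff_half_rpow_le_one (hκ : 0 < κ) (hκ1 : κ < 1) (y : ℝ) (hy : 0 ≤ y) :
    |fdiff (1 / 2) (fun y => y ^ κ) y| ≤ 1 := by
  have h1 : y ^ κ ≤ (y + 1 / 2) ^ κ := Real.rpow_le_rpow hy (by linarith) hκ.le
  have h2 : (y + 1 / 2) ^ κ ≤ y ^ κ + (1 / 2) ^ κ :=
    Real.rpow_add_le_add_rpow hy (by norm_num) hκ.le hκ1.le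
  have h3 : (1 / 2 : ℝ) ^ κ ≤ 1 := Real.rpow_le_one (by norm_num) (by norm_num) hκ.le
  simp only [fdiff]
  rw [abs_of_nonneg (by linarith)]
  linarith

theorem abs_fdiffHalf_powPrim_le_half (hκ : 0 < κ) (hκ1 : κ < 1) (y : ℝ) (hy : 0 ≤ y) :
    |fdiffHalf (powPrim κ) y| ≤ 1 / 2 := by
  have := abs_fdiff_le (h := 1 / 2) (by norm_num) (hasDerivAt_fdiff (h := 1 / 2) (by norm_num)
    (fun y (_ : 0 ≤ y) => hasDerivAt_powPrim hκ y)) (abs_fdiff_half_rpow_le_one hκ hκ1) y hy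
  calc |fdiffHalf (powPrim κ) y| ≤ 1 * (1 / 2) := this
    _ = 1 / 2 := by ring

/-- Serves the index k = 1, whose base point k - 1 = 0 is the singularity. No decay is needed there,
so subadditivity is enough. -/
theorem abs_fdiff_fdiffHalf_powPrim_le (hκ : 0 < κ) (hκ1 : κ < 1) {w : ℝ} (hw : 0 ≤ w) (y : ℝ)
    (hy : 0 ≤ y) : |fdiff w (fdiffHalf (powPrim κ)) y| ≤ 2 * min 1 w := by
  have h1 : |fdiff w (fdiffHalf (powPrim κ)) y| ≤ 2 * 1 * w :=
    abs_fdiff_le hw (hasDerivAt_fdiffHalf fun y (_ : 0 ≤ y) => hasDerivAt_powPrim hκ y)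
      (abs_fdiff_le_two_mul (by norm_num) (abs_fdiff_half_rpow_le_one hκ hκ1)) y hy
  have h2 := abs_fdiff_le_two_mul hw (abs_fdiffHalf_powPrim_le_half hκ hκ1) y hy
  rw [mul_min_of_nonneg _ _ (by norm_num : (0 : ℝ) ≤ 2)]
  exact le_min (by linarith) (by linarith)

end PowerDerivatives

/-! ### Decay of the Haar coefficients in k. -/

section HaarCoefficient

variable {α v : ℝ}

theorem theta_add_one_eq_fdiffHalf (hv : 1 / α < v) {y : ℝ} (hy : 0 ≤ y) :
    theta α (y + 1) v = fdiffHalf (powPrim (v - 1 / α)) y := by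
  rw [theta_eq_powPrim hv (by linarith)]
  simp only [fdiffHalf, fdiff]
  rw [show y + 1 - 1 / 2 = y + 1 / 2 by ring, show y + 1 / 2 + 1 / 2 = y + 1 by ring,
    show y + 1 - 1 = y by ring]
  ring

theorem theta_sub_theta_eq_fdiff (hv : 1 / α < v) {w x : ℝ} (hw : 0 ≤ w) (hx : 1 ≤ x) :
    theta α (w + x) v - theta α x v = fdiff w (fdiffHalf (powPrim (v - 1 / α))) (x - 1) := by
  have h1 := theta_add_one_eq_fdiffHalf hv (y := x - 1 + w) (by linarith)
  have h2 := theta_add_one_eq_fdiffHalf hv (y := x - 1) (by linarith)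
  rw [show x - 1 + w + 1 = w + x by ring] at h1
  rw [sub_add_cancel] at h2
  rw [h1, h2, fdiff]

/-- Moves the bounds from the base point k - 1 to k. The factor 8 = 2^3 covers every exponent that
occurs, the lowest being κ - 3 > -3. -/
theorem rpow_sub_one_le {k p : ℝ} (hk : 2 ≤ k) (hp : p ≤ 0) (hp3 : -3 ≤ p) :
    (k - 1) ^ p ≤ 8 * k ^ p := by
  have h1 : (k - 1) ^ p ≤ (k / 2) ^ p :=
    Real.rpow_le_rpow_of_nonpos (by linarith) (by linarith) hp
  have h2 : (k / 2) ^ p = k ^ p * 2 ^ (-p) := by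
    rw [div_eq_mul_inv, Real.mul_rpow (by linarith) (by norm_num), Real.inv_rpow (by norm_num),
      Real.rpow_neg (by norm_num)]
  have h3 : (2 : ℝ) ^ (-p) ≤ 2 ^ (3 : ℝ) := Real.rpow_le_rpow_of_exponent_le (by norm_num)
    (by linarith)
  have h4 : (2 : ℝ) ^ (3 : ℝ) = 8 := by norm_num
  have h5 : 0 ≤ k ^ p := Real.rpow_nonneg (by linarith) p
  rw [h2] at h1
  nlinarith

theorem rpow_sub_one_eq_div {k : ℝ} (hk : 0 < k) (p : ℝ) : k ^ (p - 1) = k ^ p / k := by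
  rw [Real.rpow_sub hk, Real.rpow_one]

/-- The minimum records two bounds for a difference of step w: twice the supremum, or w times the
derivative, which is smaller by a factor of order 1/k. -/
theorem abs_theta_sub_theta_le (hv : 1 / α < v) (hv1 : v - 1 / α < 1) {w : ℝ} (hw : 0 ≤ w)
    {k : ℕ} (hk : 1 ≤ k) :
    |theta α (w + k) v - theta α k v| ≤ 8 * (k : ℝ) ^ (v - 1 / α - 1) * min 1 (w / k) := by
  have hκ : 0 < v - 1 / α := by linarith
  have hk' : (1 : ℝ) ≤ k := by exact_mod_cast hk
  have hk0 : (0 : ℝ) < k := by linarith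
  rw [theta_sub_theta_eq_fdiff hv hw hk']
  rcases eq_or_lt_of_le hk with rfl | hk2
  · have := abs_fdiff_fdiffHalf_powPrim_le hκ hv1 hw (((1 : ℕ) : ℝ) - 1) (by simp)
    have h0 : 0 ≤ min 1 w := le_min zero_le_one hw
    simp only [Nat.cast_one, Real.one_rpow, div_one, mul_one] at this ⊢
    linarith
  · have hk2' : (2 : ℝ) ≤ k := by exact_mod_cast hk2
    have hx : (0 : ℝ) < k - 1 := by linarith
    have h1 := abs_fdiff_le_two_mul hw (abs_fdiffHalf_powPrim_le hκ hv1 hx) _ le_rfl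
    have h2 := abs_fdiff_le hw
      (hasDerivAt_fdiffHalf fun y (_ : (k : ℝ) - 1 ≤ y) => hasDerivAt_powPrim hκ y)
      (abs_fdiffHalf_rpow_le hκ hv1 hx) _ le_rfl
    have e1 := rpow_sub_one_le hk2' (p := v - 1 / α - 1) (by linarith) (by linarith)
    have e2 := rpow_sub_one_le hk2' (p := v - 1 / α - 2) (by linarith) (by linarith)
    have e3 : (k : ℝ) ^ (v - 1 / α - 2) = (k : ℝ) ^ (v - 1 / α - 1) / k := by
      rw [← rpow_sub_one_eq_div hk0]
      ring_nf
    have p1 : 0 ≤ (k : ℝ) ^ (v - 1 / α - 1) := by positivity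
    rw [mul_min_of_nonneg _ _ (by positivity)]
    refine le_min (by linarith) (h2.trans ?_)
    rw [e3] at e2
    have e4 : (k : ℝ) ^ (v - 1 / α - 1) / k * w = (k : ℝ) ^ (v - 1 / α - 1) * (w / k) := by ring
    have p2 : 0 ≤ (k : ℝ) ^ (v - 1 / α - 1) * (w / k) := by positivity
    nlinarith

/-- Differencing in k gains one more power of k. The differences of steps 1 and w commute, so the
step-w one can be estimated last by either of the two bounds. -/
theorem abs_theta_sub_theta_diff_le (hv : 1 / α < v) (hv1 : v - 1 / α < 1) {w : ℝ} (hw : 0 ≤ w)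
    {k : ℕ} (hk : 1 ≤ k) :
    |(theta α (w + k) v - theta α k v)
      - (theta α (w + (k + 1 : ℕ)) v - theta α (k + 1 : ℕ) v)|
      ≤ 8 * (k : ℝ) ^ (v - 1 / α - 2) * min 1 (w / k) := by
  have hκ : 0 < v - 1 / α := by linarith
  have hk' : (1 : ℝ) ≤ k := by exact_mod_cast hk
  have hk0 : (0 : ℝ) < k := by linarith
  rw [theta_sub_theta_eq_fdiff hv hw hk', theta_sub_theta_eq_fdiff hv hw (by simp)]
  rcases eq_or_lt_of_le hk with rfl | hk2
  · have h1 := abs_fdiff_fdiffHalf_powPrim_le hκ hv1 hw (((1 : ℕ) : ℝ) - 1) (by simp)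
    have h2 := abs_fdiff_fdiffHalf_powPrim_le hκ hv1 hw (((1 + 1 : ℕ) : ℝ) - 1) (by simp)
    have h0 : 0 ≤ min 1 w := le_min zero_le_one hw
    refine (abs_sub _ _).trans ?_
    simp only [Nat.cast_one, Real.one_rpow, div_one, mul_one] at h1 h2 ⊢
    linarith
  · have hk2' : (2 : ℝ) ≤ k := by exact_mod_cast hk2
    have hx : (0 : ℝ) < k - 1 := by linarith
    set Θ := fdiffHalf (powPrim (v - 1 / α)) with hΘ
    have hd := hasDerivAt_fdiffHalf (x := (k : ℝ) - 1) fun y _ => hasDerivAt_powPrim hκ y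
    have hd' := hasDerivAt_fdiffHalf (x := (k : ℝ) - 1)
      fun y hy => hasDerivAt_rpow_first (κ := v - 1 / α) (hx.trans_le hy)
    have h1 := abs_fdiff_le_two_mul hw
      (abs_fdiff_le zero_le_one hd (abs_fdiffHalf_rpow_le hκ hv1 hx)) _ le_rfl
    have h2 := abs_fdiff_le zero_le_one (hasDerivAt_fdiff hw hd)
      (abs_fdiff_le hw hd' (abs_fdiffHalf_deriv_rpow_le hκ hv1 hx)) _ le_rfl
    have s1 : |fdiff w Θ (k - 1) - fdiff w Θ ((k + 1 : ℕ) - 1)|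
        = |fdiff w (fdiff 1 Θ) (k - 1)| := by
      rw [abs_sub_comm]
      simp only [fdiff]
      push_cast
      congr 1
      ring_nf
    have s2 : fdiff 1 (fdiff w Θ) (k - 1) = fdiff w (fdiff 1 Θ) (k - 1) := by
      simp only [fdiff]
      ring_nf
    rw [s1]
    rw [← hΘ, s2] at h2
    have e2 := rpow_sub_one_le hk2' (p := v - 1 / α - 2) (by linarith) (by linarith)
    have e1 := rpow_sub_one_le hk2' (p := v - 1 / α - 3) (by linarith) (by linarith)
    have e3 : (k : ℝ) ^ (v - 1 / α - 3) = (k : ℝ) ^ (v - 1 / α - 2) / k := by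
      rw [← rpow_sub_one_eq_div hk0]
      ring_nf
    have p1 : 0 ≤ (k : ℝ) ^ (v - 1 / α - 2) := by positivity
    rw [mul_min_of_nonneg _ _ (by positivity)]
    refine le_min (by linarith) (h2.trans ?_)
    rw [e3] at e1
    have e4 : (k : ℝ) ^ (v - 1 / α - 2) / k * w = (k : ℝ) ^ (v - 1 / α - 2) * (w / k) := by ring
    have p2 : 0 ≤ (k : ℝ) ^ (v - 1 / α - 2) * (w / k) := by positivity
    nlinarith

end HaarCoefficient

/-! ### Dilated and translated Haar functions -/

/-- The function `s ↦ h(2^j s - k)`. -/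
noncomputable def haarAt (j k : ℤ) : SimpleFunc ℝ ℝ :=
  haar.comp (fun s : ℝ => (2 : ℝ) ^ j * s - (k : ℝ))
    ((measurable_const.mul measurable_id).sub measurable_const)

theorem zeta_eq {Ω : Type*} (α : ℝ) (Z : Set ℝ → Ω → ℝ) (j k : ℤ) (ω : Ω) :
    zeta α Z j k ω = (2 : ℝ) ^ ((j : ℝ) / α) * simpleIntegral Z (haarAt j k) ω := rfl

theorem haarAt_neg_apply (j : ℤ) (k : ℕ) (s : ℝ) :
    haarAt j (-(k : ℤ)) s = haar ((2 : ℝ) ^ j * s + k) := by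
  simp [haarAt]

theorem haar_eq_zero {y : ℝ} (hy : y ∉ Ico (0 : ℝ) 1) : haar y = 0 := by
  rw [haar_apply, indicator_of_notMem, indicator_of_notMem, sub_zero]
  · exact fun h => hy ⟨by linarith [h.1], h.2⟩
  · exact fun h => hy ⟨h.1, by linarith [h.2]⟩

theorem abs_haar_le_one (y : ℝ) : |haar y| ≤ 1 := by
  rw [haar_apply]
  by_cases h1 : y ∈ Ico (0 : ℝ) (1 / 2)
  · have h2 : y ∉ Ico (1 / 2 : ℝ) 1 := fun h => absurd h.1 (not_le.mpr h1.2)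
    rw [indicator_of_mem h1, indicator_of_notMem h2]
    simp
  · rw [indicator_of_notMem h1]
    by_cases h2 : y ∈ Ico (1 / 2 : ℝ) 1
    · rw [indicator_of_mem h2]
      simp
    · rw [indicator_of_notMem h2]
      simp

theorem eq_neg_floor_of_haar_ne_zero {y : ℝ} {k : ℤ} (h : haar (y + k) ≠ 0) : k = -⌊y⌋ := by
  have hmem : y + k ∈ Ico (0 : ℝ) 1 := by
    by_contra hc
    exact h (haar_eq_zero hc)
  have : ⌊y⌋ = -k := by
    rw [Int.floor_eq_iff]
    push_cast
    exact ⟨by linarith [hmem.1], by linarith [hmem.2]⟩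
  omega

/-- The dyadic interval that carries `h(2^j s + k)`. -/
noncomputable def dyadicIco (j : ℤ) (k : ℕ) : Set ℝ :=
  Ico (-(k : ℝ) * (2 : ℝ) ^ (-j)) ((1 - k : ℝ) * (2 : ℝ) ^ (-j))

theorem volume_dyadicIco (j : ℤ) (k : ℕ) :
    volume (dyadicIco j k) = ENNReal.ofReal ((2 : ℝ) ^ (-j)) := by
  rw [dyadicIco, Real.volume_Ico]
  congr 1
  ring

theorem mem_dyadicIco_of_haar_ne_zero {j : ℤ} {k : ℕ} {s : ℝ}
    (h : haar ((2 : ℝ) ^ j * s + k) ≠ 0) : s ∈ dyadicIco j k := by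
  have hmem : (2 : ℝ) ^ j * s + k ∈ Ico (0 : ℝ) 1 := by
    by_contra hc
    exact h (haar_eq_zero hc)
  have hp : (0 : ℝ) < 2 ^ j := by positivity
  rw [dyadicIco, zpow_neg, ← div_eq_mul_inv, ← div_eq_mul_inv]
  exact ⟨(div_le_iff₀ hp).2 (by linarith [hmem.1]), (lt_div_iff₀ hp).2 (by linarith [hmem.2])⟩

theorem finMeasSupp_haarAt (j : ℤ) (k : ℕ) : (haarAt j (-(k : ℤ))).FinMeasSupp volume := by
  rw [SimpleFunc.finMeasSupp_iff_support]
  refine (measure_mono (t := dyadicIco j k) fun s hs => ?_).trans_lt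
    (by rw [volume_dyadicIco]; exact ENNReal.ofReal_lt_top)
  rw [Function.mem_support, haarAt_neg_apply] at hs
  exact mem_dyadicIco_of_haar_ne_zero hs

theorem abs_sum_haar_le {j : ℤ} {S : Finset ℕ} {c : ℕ → ℝ} {C : ℝ} (hC : 0 ≤ C)
    (hc : ∀ k ∈ S, |c k| ≤ C) (s : ℝ) :
    |∑ k ∈ S, c k * haar ((2 : ℝ) ^ j * s + k)|
      ≤ (⋃ k ∈ S, dyadicIco j k).indicator (fun _ => C) s := by
  by_cases h : ∃ k ∈ S, haar ((2 : ℝ) ^ j * s + k) ≠ 0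
  · obtain ⟨k, hk, hne⟩ := h
    rw [Finset.sum_eq_single_of_mem k hk, indicator_of_mem, abs_mul]
    · exact (mul_le_mul (hc k hk) (abs_haar_le_one _) (abs_nonneg _) hC).trans_eq (mul_one C)
    · exact mem_biUnion hk (mem_dyadicIco_of_haar_ne_zero hne)
    · intro k' _ hkk
      by_contra hne'
      refine hkk ?_
      have h1 := eq_neg_floor_of_haar_ne_zero (y := (2 : ℝ) ^ j * s) (k := (k : ℤ))
        (by simpa using hne)
      have h2 := eq_neg_floor_of_haar_ne_zero (y := (2 : ℝ) ^ j * s) (k := (k' : ℤ))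
        (by simpa using right_ne_zero_of_mul hne')
      omega
  · push Not at h
    rw [Finset.sum_eq_zero fun k hk => by rw [h k hk, mul_zero], abs_zero]
    exact indicator_nonneg (fun _ _ => hC) _

theorem coe_simpleFunc_sum {ι : Type*} (S : Finset ι) (f : ι → SimpleFunc ℝ ℝ) (s : ℝ) :
    (∑ i ∈ S, f i) s = ∑ i ∈ S, f i s := by
  classical
  induction S using Finset.induction_on with
  | empty => simp
  | insert i S hi ih => rw [Finset.sum_insert hi, Finset.sum_insert hi, SimpleFunc.add_apply, ih]

/-- Haar functions of one level have disjoint supports, each of measure at most 2^{-j}, so no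
triangle inequality is needed within a level; the normalisation 2^{j/α} cancels that measure. -/
theorem eLpNorm_sum_haarAt_le {α : ℝ} (hα : 0 < α) (j : ℤ) {S : Finset ℕ} {c : ℕ → ℝ} {C : ℝ}
    (hC : 0 ≤ C) (hc : ∀ k ∈ S, |c k| ≤ C) :
    eLpNorm (∑ k ∈ S, c k • (2 : ℝ) ^ ((j : ℝ) / α) • haarAt j (-(k : ℤ)) : SimpleFunc ℝ ℝ)
      (ENNReal.ofReal α) volume ≤ ENNReal.ofReal (C * (S.card : ℝ) ^ (1 / α)) := by
  have hp : (0 : ℝ) < 2 ^ ((j : ℝ) / α) := by positivity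
  have hpt : ∀ s, ‖(∑ k ∈ S, c k • (2 : ℝ) ^ ((j : ℝ) / α) • haarAt j (-(k : ℤ)) :
      SimpleFunc ℝ ℝ) s‖ ≤ ‖(⋃ k ∈ S, dyadicIco j k).indicator
        (fun _ => C * (2 : ℝ) ^ ((j : ℝ) / α)) s‖ := by
    intro s
    have h0 := abs_sum_haar_le (j := j) (S := S) (c := fun k => c k * (2 : ℝ) ^ ((j : ℝ) / α))
      (C := C * (2 : ℝ) ^ ((j : ℝ) / α)) (by positivity) (fun k hk => by
        rw [abs_mul, abs_of_pos hp]
        exact mul_le_mul_of_nonneg_right (hc k hk) hp.le) s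
    rw [Real.norm_eq_abs, Real.norm_eq_abs, coe_simpleFunc_sum]
    refine le_trans (le_of_eq ?_) (h0.trans (le_abs_self _))
    congr 1
    refine Finset.sum_congr rfl fun k _ => ?_
    rw [SimpleFunc.smul_apply, SimpleFunc.smul_apply, haarAt_neg_apply]
    simp [mul_assoc]
  refine (eLpNorm_mono hpt).trans ?_
  have hm : MeasurableSet (⋃ k ∈ S, dyadicIco j k) :=
    Finset.measurableSet_biUnion _ fun _ _ => measurableSet_Ico
  rw [eLpNorm_indicator_const hm (by simpa using hα) ENNReal.ofReal_ne_top,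
    ENNReal.toReal_ofReal hα.le]
  have hvol : volume (⋃ k ∈ S, dyadicIco j k) ≤ ENNReal.ofReal (S.card * (2 : ℝ) ^ (-j)) := by
    refine (measure_biUnion_finset_le _ _).trans ?_
    simp only [volume_dyadicIco, Finset.sum_const, nsmul_eq_mul]
    rw [ENNReal.ofReal_mul (by positivity), ENNReal.ofReal_natCast]
  calc ‖C * (2 : ℝ) ^ ((j : ℝ) / α)‖ₑ * volume (⋃ k ∈ S, dyadicIco j k) ^ (1 / α)
      ≤ ENNReal.ofReal (C * (2 : ℝ) ^ ((j : ℝ) / α))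
        * ENNReal.ofReal (S.card * (2 : ℝ) ^ (-j)) ^ (1 / α) := by
        rw [Real.enorm_eq_ofReal (by positivity)]
        gcongr
    _ = ENNReal.ofReal (C * (S.card : ℝ) ^ (1 / α)) := by
        rw [ENNReal.ofReal_rpow_of_nonneg (by positivity) (by positivity),
          ← ENNReal.ofReal_mul (by positivity), Real.mul_rpow (by positivity) (by positivity),
          ← Real.rpow_intCast, ← Real.rpow_mul (by norm_num)]
        congr 1
        have : (2 : ℝ) ^ ((j : ℝ) / α) * (2 : ℝ) ^ (((-j : ℤ) : ℝ) * (1 / α)) = 1 := by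
          rw [← Real.rpow_add (by norm_num)]
          push_cast
          rw [show (j : ℝ) / α + -(j : ℝ) * (1 / α) = 0 by ring, Real.rpow_zero]
        calc _ = C * (S.card : ℝ) ^ (1 / α)
              * ((2 : ℝ) ^ ((j : ℝ) / α) * (2 : ℝ) ^ (((-j : ℤ) : ℝ) * (1 / α))) := by ring
          _ = _ := by rw [this, mul_one]

/-! ### Sums over the truncated dyadic tree -/

section DyadicSum

variable {A : Type*} [AddCommGroup A] [Module ℝ A]

/-- `∑_{j=1-J}^{J-1} c_j ∑_{k=1}^{2^{J-|j|}} T_{j,k}`. -/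
noncomputable def dyadicSum (c : ℤ → ℝ) (T : ℤ → ℕ → A) (J : ℕ) : A :=
  ∑ j ∈ Finset.Icc (1 - (J : ℤ)) ((J : ℤ) - 1), c j •
    ∑ k ∈ Finset.Icc (1 : ℕ) (2 ^ (J - j.natAbs)), T j k

/-- The last index on the level `j` of the tree truncated at `J`. -/
def dyadicCut (J : ℕ) (j : ℤ) : ℕ := if j.natAbs < J then 2 ^ (J - j.natAbs) else 0

theorem dyadicCut_succ {J : ℕ} {j : ℤ} (hj : j ∈ Finset.Icc (-(J : ℤ)) J) :
    dyadicCut (J + 1) j = 2 * 2 ^ (J - j.natAbs) := by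
  rw [Finset.mem_Icc] at hj
  rw [dyadicCut, if_pos (by omega), show J + 1 - j.natAbs = (J - j.natAbs) + 1 by omega, pow_succ,
    mul_comm]

/-- On an old level |j| < J the cut is K = 2^{J-|j|} itself; on a new level |j| = J it is 0 while K
= 1. The `+ 1` covers both, so every new index is at least K. -/
theorem le_dyadicCut_add_one (J : ℕ) (j : ℤ) : 2 ^ (J - j.natAbs) ≤ dyadicCut J j + 1 := by
  rw [dyadicCut]
  split_ifs with h
  · omega
  · rw [show J - j.natAbs = 0 by omega]
    simp

theorem dyadicCut_le_succ {J : ℕ} {j : ℤ} (hj : j ∈ Finset.Icc (-(J : ℤ)) J) :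
    dyadicCut J j ≤ dyadicCut (J + 1) j := by
  rw [dyadicCut_succ hj, dyadicCut]
  split_ifs <;> omega

theorem dyadicSum_eq_sum_cut (c : ℤ → ℝ) (T : ℤ → ℕ → A) (J : ℕ) :
    dyadicSum c T J
      = ∑ j ∈ Finset.Icc (-(J : ℤ)) J, c j • ∑ k ∈ Finset.Ioc 0 (dyadicCut J j), T j k := by
  rw [dyadicSum]
  have hsub : Finset.Icc (1 - (J : ℤ)) ((J : ℤ) - 1) ⊆ Finset.Icc (-(J : ℤ)) J :=
    Finset.Icc_subset_Icc (by omega) (by omega)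
  refine (Finset.sum_congr rfl fun j hj => ?_).trans (Finset.sum_subset hsub fun j hj hj' => ?_)
  · rw [Finset.mem_Icc] at hj
    rw [dyadicCut, if_pos (by omega)]
    rfl
  · rw [Finset.mem_Icc] at hj hj'
    rw [dyadicCut, if_neg (by omega)]
    simp

theorem dyadicSum_succ_sub (c : ℤ → ℝ) (T : ℤ → ℕ → A) (J : ℕ) :
    dyadicSum c T (J + 1) - dyadicSum c T J
      = ∑ j ∈ Finset.Icc (-(J : ℤ)) J, c j •
          ∑ k ∈ Finset.Ioc (dyadicCut J j) (dyadicCut (J + 1) j), T j k := by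
  rw [dyadicSum_eq_sum_cut c T J]
  have h1 : dyadicSum c T (J + 1) = ∑ j ∈ Finset.Icc (-(J : ℤ)) J, c j •
      ∑ k ∈ Finset.Ioc 0 (dyadicCut (J + 1) j), T j k := by
    rw [dyadicSum]
    have : Finset.Icc (1 - ((J + 1 : ℕ) : ℤ)) (((J + 1 : ℕ) : ℤ) - 1)
        = Finset.Icc (-(J : ℤ)) J := by
      congr 1 <;> push_cast <;> ring
    rw [this]
    refine Finset.sum_congr rfl fun j hj => ?_
    rw [Finset.mem_Icc] at hj
    rw [dyadicCut, if_pos (by omega)]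
    rfl
  rw [h1, ← Finset.sum_sub_distrib]
  refine Finset.sum_congr rfl fun j hj => ?_
  rw [← smul_sub, ← Finset.sum_Ioc_consecutive _ (Nat.zero_le _) (dyadicCut_le_succ hj),
    add_sub_cancel_left]

end DyadicSum

/-! ### The numerical estimate behind both convergence statements -/

theorem sum_Icc_natAbs_le {f : ℕ → ℝ} (hf : ∀ n, 0 ≤ f n) (J : ℕ) :
    ∑ j ∈ Finset.Icc (-(J : ℤ)) J, f j.natAbs ≤ 2 * ∑ n ∈ Finset.range (J + 1), f n := by
  induction J with
  | zero => simp; linarith [hf 0]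
  | succ J ih =>
    have : Finset.Icc (-((J + 1 : ℕ) : ℤ)) ((J + 1 : ℕ) : ℤ)
        = insert (-((J + 1 : ℕ) : ℤ)) (insert (((J + 1 : ℕ) : ℤ)) (Finset.Icc (-(J : ℤ)) J)) := by
      ext j
      simp only [Finset.mem_Icc, Finset.mem_insert]
      omega
    rw [this, Finset.sum_insert, Finset.sum_insert, Finset.sum_range_succ _ (J + 1)]
    · simp only [Int.natAbs_neg, Int.natAbs_natCast]
      linarith
    · simp only [Finset.mem_Icc]; omega
    · simp only [Finset.mem_Icc, Finset.mem_insert]; omega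

/-- Put n = |j| and m = J - n. For j < 0 the entry 2^j/K of the minimum gives exactly the first
geometric term. For j ≥ 0 the entry 1 is used when m ≤ n and 2^{n-m} when n ≤ m; both leave the
second term, whose rate 2a - 1 - ε reflects the factor 2^{-n(2v-1)}. -/
theorem level_weight_le {a v ε : ℝ} (hav : a ≤ v) (hε : 0 ≤ ε) (hε1 : ε ≤ 1) {J : ℕ} {j : ℤ}
    (hj : j ∈ Finset.Icc (-(J : ℤ)) J) :
    (2 : ℝ) ^ (-(j : ℝ) * v) * (((2 ^ (J - j.natAbs) : ℕ) : ℝ) ^ (v - 1 + ε)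
        * min 1 ((2 : ℝ) ^ j / (2 ^ (J - j.natAbs) : ℕ)))
      ≤ (2 : ℝ) ^ (-(J : ℝ) * (1 - v)) * (((2 : ℝ) ^ (-(1 - ε))) ^ (J - j.natAbs)
        + ((2 : ℝ) ^ (-(2 * a - 1 - ε))) ^ j.natAbs) := by
  rw [Finset.mem_Icc] at hj
  obtain ⟨m, hm⟩ : ∃ m : ℕ, J = j.natAbs + m := ⟨J - j.natAbs, by omega⟩
  set n := j.natAbs with hn
  have hmJ : J - n = m := by omega
  have hJ : (J : ℝ) = n + m := by rw [hm]; push_cast; ring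
  rw [hmJ, hJ]
  have e0 : ((2 ^ m : ℕ) : ℝ) = (2 : ℝ) ^ (m : ℝ) := by push_cast; rw [Real.rpow_natCast]
  have e1 : (2 : ℝ) ^ j = (2 : ℝ) ^ (j : ℝ) := (Real.rpow_intCast 2 j).symm
  have two0 : (0 : ℝ) < 2 := by norm_num
  rw [e0, e1, ← Real.rpow_mul two0.le, ← Real.rpow_sub two0, ← Real.rpow_natCast _ m,
    ← Real.rpow_natCast _ n, ← Real.rpow_mul two0.le, ← Real.rpow_mul two0.le,
    mul_add ((2 : ℝ) ^ (-((n : ℝ) + m) * (1 - v))),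
    ← Real.rpow_add two0, ← Real.rpow_add two0, ← mul_assoc, ← Real.rpow_add two0]
  have hm0 : (0 : ℝ) ≤ m := Nat.cast_nonneg m
  have hn0 : (0 : ℝ) ≤ n := Nat.cast_nonneg n
  have pos1 := Real.rpow_pos_of_pos two0 (-((n : ℝ) + m) * (1 - v) + -(1 - ε) * m)
  have pos2 := Real.rpow_pos_of_pos two0 (-((n : ℝ) + m) * (1 - v) + -(2 * a - 1 - ε) * n)
  rcases le_or_gt 0 j with h0 | h0
  · have hjn : (j : ℝ) = n := by
      have : j = (n : ℤ) := by omega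
      rw [this]; simp
    rw [hjn]
    refine le_trans ?_ (le_add_of_nonneg_left pos1.le)
    rcases le_total (m : ℝ) n with hmn | hmn
    · calc _ ≤ (2 : ℝ) ^ (-(n : ℝ) * v + m * (v - 1 + ε)) * 1 := by
            gcongr; exact min_le_left _ _
        _ ≤ _ := by
            rw [mul_one]
            refine Real.rpow_le_rpow_of_exponent_le (by norm_num) ?_
            nlinarith [mul_nonneg hn0 (sub_nonneg.2 hav), mul_nonneg hε (sub_nonneg.2 hmn)]
    · calc _ ≤ (2 : ℝ) ^ (-(n : ℝ) * v + m * (v - 1 + ε)) * (2 : ℝ) ^ ((n : ℝ) - m) := by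
            gcongr; exact min_le_right _ _
        _ ≤ _ := by
            rw [← Real.rpow_add two0]
            refine Real.rpow_le_rpow_of_exponent_le (by norm_num) ?_
            nlinarith [mul_nonneg hn0 (sub_nonneg.2 hav),
              mul_nonneg (sub_nonneg.2 hε1) (sub_nonneg.2 hmn)]
  · have hjn : (j : ℝ) = -(n : ℝ) := by
      have : j = -(n : ℤ) := by omega
      rw [this]; simp
    rw [hjn]
    refine le_trans ?_ (le_add_of_nonneg_right pos2.le)
    calc _ ≤ (2 : ℝ) ^ (-(-(n : ℝ)) * v + m * (v - 1 + ε)) * (2 : ℝ) ^ (-(n : ℝ) - m) := by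
          gcongr; exact min_le_right _ _
      _ ≤ _ := by
          rw [← Real.rpow_add two0]
          refine Real.rpow_le_rpow_of_exponent_le (by norm_num) ?_
          nlinarith

theorem geom_sum_range_le {r : ℝ} (h0 : 0 ≤ r) (h1 : r < 1) (n : ℕ) :
    ∑ i ∈ Finset.range n, r ^ i ≤ (1 - r)⁻¹ := by
  rw [← tsum_geometric_of_lt_one h0 h1]
  exact (summable_geometric_of_lt_one h0 h1).sum_le_tsum _ fun i _ => pow_nonneg h0 i

/-- There is a constant, uniform in `v ≥ a`, for the sum over all levels. -/
theorem exists_sum_level_weight_le {a ε : ℝ} (hε : 0 ≤ ε) (hε1 : ε < 1) (hεa : ε < 2 * a - 1) :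
    ∃ C : ℝ, 0 ≤ C ∧ ∀ v, a ≤ v → ∀ J : ℕ,
      ∑ j ∈ Finset.Icc (-(J : ℤ)) J, (2 : ℝ) ^ (-(j : ℝ) * v)
        * (((2 ^ (J - j.natAbs) : ℕ) : ℝ) ^ (v - 1 + ε)
          * min 1 ((2 : ℝ) ^ j / (2 ^ (J - j.natAbs) : ℕ)))
      ≤ C * (2 : ℝ) ^ (-(J : ℝ) * (1 - v)) := by
  set ρ := (2 : ℝ) ^ (-(1 - ε)) with hρ
  set τ := (2 : ℝ) ^ (-(2 * a - 1 - ε)) with hτ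
  have hρ0 : 0 ≤ ρ := by positivity
  have hτ0 : 0 ≤ τ := by positivity
  have hρ1 : ρ < 1 := Real.rpow_lt_one_of_one_lt_of_neg (by norm_num) (by linarith)
  have hτ1 : τ < 1 := Real.rpow_lt_one_of_one_lt_of_neg (by norm_num) (by linarith)
  refine ⟨2 * ((1 - ρ)⁻¹ + (1 - τ)⁻¹), ?_, fun v hv J => ?_⟩
  · have := inv_pos.2 (sub_pos.2 hρ1)
    have := inv_pos.2 (sub_pos.2 hτ1)
    positivity
  · refine (Finset.sum_le_sum fun j hj => level_weight_le hv hε hε1.le hj).trans ?_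
    rw [← Finset.mul_sum, mul_comm]
    refine mul_le_mul_of_nonneg_right ?_ (by positivity)
    refine (sum_Icc_natAbs_le (f := fun n => ρ ^ (J - n) + τ ^ n)
      (fun n => by positivity) J).trans ?_
    refine mul_le_mul_of_nonneg_left ?_ (by norm_num)
    rw [Finset.sum_add_distrib]
    refine add_le_add ?_ (geom_sum_range_le hτ0 hτ1 _)
    have := Finset.sum_range_reflect (fun i => ρ ^ i) (J + 1)
    simp only [Nat.add_sub_cancel] at this
    rw [this]
    exact geom_sum_range_le hρ0 hρ1 _

/-! ### Dyadic averages of the kernel -/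

section Telescoping

variable {κ u s : ℝ}

/-- The mean of `t ^ κ` over `[x - 1, x]`. -/
noncomputable def powMean (κ x : ℝ) : ℝ := powPrim κ x - powPrim κ (x - 1)

theorem powMean_mem_Icc (hκ : 0 < κ) {x : ℝ} (hx : 1 ≤ x) :
    powMean κ x ∈ Icc ((x - 1) ^ κ) (x ^ κ) := by
  obtain ⟨c, hc, hce⟩ := exists_hasDerivAt_eq_slope (powPrim κ) (fun y => y ^ κ)
    (show x - 1 < x by linarith)
    (fun y _ => (hasDerivAt_powPrim hκ y).continuousAt.continuousWithinAt)
    (fun y _ => hasDerivAt_powPrim hκ y)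
  have : powMean κ x = c ^ κ := by rw [powMean, hce]; ring
  rw [this]
  exact ⟨Real.rpow_le_rpow (by linarith) hc.1.le hκ.le,
    Real.rpow_le_rpow (by linarith [hc.1]) hc.2.le hκ.le⟩

/-- The derivative of the mean is a unit difference of t^κ, at most 1 by subadditivity. This handles
the coarse levels. -/
theorem abs_powMean_sub_le (hκ : 0 < κ) (hκ1 : κ < 1) {w : ℝ} (hw : 0 ≤ w) :
    |powMean κ (w + 1) - powMean κ 1| ≤ w := by
  have h1 : ∀ y : ℝ, 0 ≤ y → |fdiff 1 (fun y => y ^ κ) y| ≤ 1 := by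
    intro y hy
    have h1 : y ^ κ ≤ (y + 1) ^ κ := Real.rpow_le_rpow hy (by linarith) hκ.le
    have h2 : (y + 1) ^ κ ≤ y ^ κ + 1 ^ κ :=
      Real.rpow_add_le_add_rpow hy (by norm_num) hκ.le hκ1.le
    rw [Real.one_rpow] at h2
    simp only [fdiff]
    rw [abs_of_nonneg (by linarith)]
    linarith
  have := abs_fdiff_le hw (hasDerivAt_fdiff zero_le_one
    (fun y (_ : 0 ≤ y) => hasDerivAt_powPrim hκ y)) h1 0 le_rfl
  simp only [fdiff, zero_add, one_mul] at this
  simpa [powMean] using this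

theorem powPrim_two_mul {x : ℝ} (hx : 0 ≤ x) :
    powPrim κ (2 * x) = 2 ^ (κ + 1) * powPrim κ x := by
  rw [powPrim, powPrim, Real.mul_rpow (by norm_num) hx]
  ring

/-- The mean of `(u - t) ^ κ - (-t) ^ κ` over the dyadic interval of length `2^{-j}` that
contains `s`. -/
noncomputable def kernelMean (κ u s : ℝ) (j : ℤ) : ℝ :=
  (2 : ℝ) ^ (-(j : ℝ) * κ) * (powMean κ ((2 : ℝ) ^ j * u + (-⌊(2 : ℝ) ^ j * s⌋ : ℤ))
    - powMean κ (-⌊(2 : ℝ) ^ j * s⌋ : ℤ))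

theorem one_le_neg_floor {y : ℝ} (hy : y < 0) : 1 ≤ -⌊y⌋ := by
  have : ⌊y⌋ < 0 := Int.floor_lt.2 (by simpa using hy)
  omega

/-- Halving the dyadic interval around s changes the average by the Haar coefficient times the sign
of the half containing s. The two cases are these halves; doubling the argument of the primitive
produces 2^{κ+1}, which offsets the change of scale. -/
theorem kernelMean_succ_sub {α v : ℝ} (hv : 1 / α < v) (hu : 0 ≤ u) (hs : s < 0) (j : ℤ) :
    kernelMean (v - 1 / α) u s (j + 1) - kernelMean (v - 1 / α) u s j
      = (2 : ℝ) ^ (-(j : ℝ) * (v - 1 / α))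
        * ((theta α ((2 : ℝ) ^ j * u + (-⌊(2 : ℝ) ^ j * s⌋ : ℤ)) v
            - theta α (-⌊(2 : ℝ) ^ j * s⌋ : ℤ) v)
          * haar ((2 : ℝ) ^ j * s + (-⌊(2 : ℝ) ^ j * s⌋ : ℤ))) := by
  have hp : (0 : ℝ) < 2 ^ j := by positivity
  have hy : (2 : ℝ) ^ j * s < 0 := mul_neg_of_pos_of_neg hp hs
  have hw : 0 ≤ (2 : ℝ) ^ j * u := by positivity
  set κ := v - 1 / α with hκ
  have e1 : (2 : ℝ) ^ (j + 1) = 2 * 2 ^ j := by rw [zpow_add_one₀ (by norm_num)]; ring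
  have e2 : (2 : ℝ) ^ (-((j + 1 : ℤ) : ℝ) * κ) * 2 ^ (κ + 1) = 2 * 2 ^ (-(j : ℝ) * κ) := by
    rw [← Real.rpow_add (by norm_num)]
    have : -((j + 1 : ℤ) : ℝ) * κ + (κ + 1) = -(j : ℝ) * κ + 1 := by push_cast; ring
    rw [this, Real.rpow_add (by norm_num), Real.rpow_one]
    ring
  set y := (2 : ℝ) ^ j * s with hydef
  set w := (2 : ℝ) ^ j * u with hwdef
  have hk := one_le_neg_floor hy
  have hfl := Int.floor_le y
  have hlt := Int.lt_floor_add_one y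
  have hkR : (1 : ℝ) ≤ ((-⌊y⌋ : ℤ) : ℝ) := by exact_mod_cast hk
  have hcast : ((-⌊y⌋ : ℤ) : ℝ) = -(⌊y⌋ : ℝ) := by push_cast; ring
  rw [theta_eq_powPrim hv (by linarith), theta_eq_powPrim hv hkR, ← hκ]
  simp only [kernelMean]
  rw [e1, mul_assoc 2, ← hydef, mul_assoc 2, ← hwdef]
  set k : ℝ := ((-⌊y⌋ : ℤ) : ℝ) with hkdef
  by_cases hhalf : y + k < 1 / 2
  · have hf : ⌊2 * y⌋ = 2 * ⌊y⌋ := by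
      rw [Int.floor_eq_iff]
      push_cast
      constructor <;> linarith
    have hh : haar (y + k) = 1 := by
      rw [haar_apply, indicator_of_mem, indicator_of_notMem, sub_zero]
      · exact fun h => absurd h.1 (not_le.2 hhalf)
      · exact ⟨by linarith, hhalf⟩
    have hk2 : ((-⌊2 * y⌋ : ℤ) : ℝ) = 2 * k := by rw [hf, hkdef]; push_cast; ring
    rw [hk2, hh]
    have g : ∀ x : ℝ, 1 ≤ x → powMean κ (2 * x)
        = 2 ^ (κ + 1) * (powPrim κ x - powPrim κ (x - 1 / 2)) := by
      intro x hx
      rw [powMean, powPrim_two_mul (by linarith), show 2 * x - 1 = 2 * (x - 1 / 2) by ring,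
        powPrim_two_mul (by linarith)]
      ring
    rw [← mul_add, g _ (by linarith), g _ hkR, ← mul_sub, ← mul_assoc, e2, powMean, powMean]
    ring
  · have hhalf' := not_lt.1 hhalf
    have hf : ⌊2 * y⌋ = 2 * ⌊y⌋ + 1 := by
      rw [Int.floor_eq_iff]
      push_cast
      constructor <;> linarith
    have hh : haar (y + k) = -1 := by
      rw [haar_apply, indicator_of_notMem, indicator_of_mem, zero_sub]
      · exact ⟨hhalf', by linarith⟩
      · exact fun h => hhalf h.2
    have hk2 : ((-⌊2 * y⌋ : ℤ) : ℝ) = 2 * k - 1 := by rw [hf, hkdef]; push_cast; ring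
    rw [hk2, hh]
    have g : ∀ x : ℝ, 1 ≤ x → powMean κ (2 * x - 1)
        = 2 ^ (κ + 1) * (powPrim κ (x - 1 / 2) - powPrim κ (x - 1)) := by
      intro x hx
      rw [powMean, show 2 * x - 1 - 1 = 2 * (x - 1) by ring, powPrim_two_mul (by linarith),
        show 2 * x - 1 = 2 * (x - 1 / 2) by ring, powPrim_two_mul (by linarith)]
      ring
    rw [← add_sub_assoc, ← mul_add, g _ (by linarith), g _ hkR, ← mul_sub, ← mul_assoc, e2, powMean,
      powMean]
    ring

theorem tendsto_two_zpow_neg_atTop : Tendsto (fun j : ℤ => (2 : ℝ) ^ (-j)) atTop (𝓝 0) := by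
  have h : Tendsto (fun j : ℤ => (2 : ℝ) ^ (-(j : ℝ))) atTop (𝓝 0) :=
    (tendsto_rpow_atBot_of_base_gt_one 2 (by norm_num)).comp
      (tendsto_neg_atTop_atBot.comp tendsto_intCast_atTop_atTop)
  refine h.congr fun j => ?_
  rw [← Real.rpow_intCast]
  push_cast
  rfl

theorem tendsto_scaled_powMean (hκ : 0 < κ) (hu : 0 ≤ u) (hs : s < 0) :
    Tendsto (fun j : ℤ => (2 : ℝ) ^ (-(j : ℝ) * κ)
      * powMean κ ((2 : ℝ) ^ j * u + (-⌊(2 : ℝ) ^ j * s⌋ : ℤ))) atTop (𝓝 ((u - s) ^ κ)) := by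
  have h0 := tendsto_two_zpow_neg_atTop
  -- The maximum keeps the base nonnegative on levels where 2^{-j} exceeds u - s.
  have hlow : Tendsto (fun j : ℤ => (max 0 (u - s - (2 : ℝ) ^ (-j))) ^ κ) atTop
      (𝓝 ((u - s) ^ κ)) := by
    have h1 : Tendsto (fun j : ℤ => max 0 (u - s - (2 : ℝ) ^ (-j))) atTop (𝓝 (u - s)) := by
      have := (tendsto_const_nhds (x := (0 : ℝ))).max (h0.const_sub (u - s))
      rwa [sub_zero, max_eq_right (by linarith)] at this
    exact h1.rpow_const (Or.inr hκ.le)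
  have hup : Tendsto (fun j : ℤ => (u - s + (2 : ℝ) ^ (-j)) ^ κ) atTop (𝓝 ((u - s) ^ κ)) := by
    have h1 : Tendsto (fun j : ℤ => u - s + (2 : ℝ) ^ (-j)) atTop (𝓝 (u - s)) := by
      simpa using h0.const_add (u - s)
    exact h1.rpow_const (Or.inr hκ.le)
  have hscale : ∀ (j : ℤ) {x : ℝ}, 0 ≤ x →
      (2 : ℝ) ^ (-(j : ℝ) * κ) * x ^ κ = ((2 : ℝ) ^ (-j) * x) ^ κ := by
    intro j x hx
    rw [Real.mul_rpow (by positivity) hx, ← Real.rpow_intCast, ← Real.rpow_mul (by norm_num)]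
    push_cast
    rfl
  have hfacts : ∀ j : ℤ, 1 ≤ (2 : ℝ) ^ j * u + ((-⌊(2 : ℝ) ^ j * s⌋ : ℤ) : ℝ)
      ∧ (2 : ℝ) ^ (-j) * ((2 : ℝ) ^ j * u + ((-⌊(2 : ℝ) ^ j * s⌋ : ℤ) : ℝ)) ≤ u - s + 2 ^ (-j)
      ∧ u - s - 2 ^ (-j)
        ≤ (2 : ℝ) ^ (-j) * ((2 : ℝ) ^ j * u + ((-⌊(2 : ℝ) ^ j * s⌋ : ℤ) : ℝ) - 1) := by
    intro j
    have hp : (0 : ℝ) < 2 ^ j := by positivity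
    have hpn : (0 : ℝ) < 2 ^ (-j) := by positivity
    have hmul : (2 : ℝ) ^ (-j) * 2 ^ j = 1 := by rw [← zpow_add₀ (by norm_num)]; simp
    have hk : (1 : ℝ) ≤ ((-⌊(2 : ℝ) ^ j * s⌋ : ℤ) : ℝ) := by
      exact_mod_cast one_le_neg_floor (mul_neg_of_pos_of_neg hp hs)
    have hfl := Int.floor_le ((2 : ℝ) ^ j * s)
    have hlt := Int.lt_floor_add_one ((2 : ℝ) ^ j * s)
    have hw : 0 ≤ (2 : ℝ) ^ j * u := by positivity
    refine ⟨by linarith, ?_, ?_⟩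
    · push_cast
      have : (2 : ℝ) ^ (-j) * (2 ^ j * u + -(⌊(2 : ℝ) ^ j * s⌋ : ℝ))
          ≤ 2 ^ (-j) * (2 ^ j * u + (1 - 2 ^ j * s)) := by gcongr; linarith
      refine this.trans (le_of_eq ?_)
      linear_combination (u - s) * hmul
    · push_cast
      have : 2 ^ (-j) * (2 ^ j * u + (-1 - 2 ^ j * s))
          ≤ (2 : ℝ) ^ (-j) * (2 ^ j * u + -(⌊(2 : ℝ) ^ j * s⌋ : ℝ) - 1) := by gcongr; linarith
      refine le_trans (le_of_eq ?_) this
      linear_combination (s - u) * hmul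
  refine tendsto_of_tendsto_of_tendsto_of_le_of_le hlow hup (fun j => ?_) (fun j => ?_)
  · obtain ⟨h1, _, h3⟩ := hfacts j
    refine le_trans ?_ (mul_le_mul_of_nonneg_left (powMean_mem_Icc hκ h1).1 (by positivity))
    rw [hscale j (by linarith)]
    exact Real.rpow_le_rpow (le_max_left _ _)
      (max_le (mul_nonneg (by positivity) (by linarith)) h3) hκ.le
  · obtain ⟨h1, h2, _⟩ := hfacts j
    refine (mul_le_mul_of_nonneg_left (powMean_mem_Icc hκ h1).2 (by positivity)).trans ?_
    rw [hscale j (by linarith)]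
    exact Real.rpow_le_rpow (mul_nonneg (by positivity) (by linarith)) h2 hκ.le

theorem tendsto_kernelMean_atTop (hκ : 0 < κ) (hu : 0 ≤ u) (hs : s < 0) :
    Tendsto (kernelMean κ u s) atTop (𝓝 ((u - s) ^ κ - (-s) ^ κ)) := by
  have h1 := tendsto_scaled_powMean hκ hu hs
  have h2 := tendsto_scaled_powMean hκ le_rfl hs
  simp only [mul_zero, zero_add, zero_sub] at h2
  refine (h1.sub h2).congr fun j => ?_
  rw [kernelMean]
  ring

/-- On coarse levels s lies in the interval [-2^{-j}, 0), so the index is 1. The difference of means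
is at most 2^j u, and 2^{-jκ} 2^j tends to 0 as j → -∞ because κ < 1. -/
theorem tendsto_kernelMean_atBot (hκ : 0 < κ) (hκ1 : κ < 1) (hu : 0 ≤ u) (hs : s < 0) :
    Tendsto (fun n : ℕ => kernelMean κ u s (1 - (n : ℤ))) atTop (𝓝 0) := by
  have hpow : Tendsto (fun n : ℕ => (2 : ℝ) ^ ((1 - (n : ℝ)) * (1 - κ)) * u) atTop (𝓝 0) := by
    have h1 : Tendsto (fun n : ℕ => (1 - (n : ℝ)) * (1 - κ)) atTop atBot := by
      refine Tendsto.atBot_mul_const (by linarith) ?_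
      exact tendsto_atBot_add_const_left _ 1 (tendsto_neg_atTop_atBot.comp
        tendsto_natCast_atTop_atTop)
    simpa using ((tendsto_rpow_atBot_of_base_gt_one 2 (by norm_num)).comp h1).mul_const u
  have hsmall : ∀ᶠ n : ℕ in atTop, (2 : ℝ) ^ (1 - (n : ℤ)) * (-s) < 1 := by
    have h2 : Tendsto (fun n : ℕ => (2 : ℝ) ^ (1 - (n : ℤ)) * (-s)) atTop (𝓝 0) := by
      have hj : Tendsto (fun n : ℕ => (n : ℤ) - 1) atTop atTop := by
        simp only [sub_eq_add_neg]
        exact tendsto_atTop_add_const_right _ _ tendsto_natCast_atTop_atTop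
      have := (tendsto_two_zpow_neg_atTop.comp hj).mul_const (-s)
      simp only [Function.comp_def, neg_sub, zero_mul] at this
      exact this
    exact h2.eventually_lt_const zero_lt_one
  refine squeeze_zero_norm' ?_ hpow
  filter_upwards [hsmall] with n hn
  have hp : (0 : ℝ) < 2 ^ (1 - (n : ℤ)) := by positivity
  have hf : ⌊(2 : ℝ) ^ (1 - (n : ℤ)) * s⌋ = -1 := by
    rw [Int.floor_eq_iff]
    push_cast
    exact ⟨by linarith, by linarith [mul_neg_of_pos_of_neg hp hs]⟩
  rw [kernelMean, hf, Real.norm_eq_abs, abs_mul, abs_of_pos (by positivity)]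
  simp only [neg_neg, Int.cast_one]
  have := abs_powMean_sub_le hκ hκ1 (w := (2 : ℝ) ^ (1 - (n : ℤ)) * u) (by positivity)
  refine (mul_le_mul_of_nonneg_left this (by positivity)).trans (le_of_eq ?_)
  rw [← Real.rpow_intCast, ← mul_assoc, ← Real.rpow_add (by norm_num)]
  congr 2
  push_cast
  ring

theorem sum_Icc_int_telescope (f : ℤ → ℝ) {a : ℤ} (n : ℕ) :
    ∑ j ∈ Finset.Icc a (a + n - 1), (f (j + 1) - f j) = f (a + n) - f a := by
  induction n with
  | zero => simp
  | succ n ih =>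
    have : Finset.Icc a (a + (n + 1 : ℕ) - 1) = insert (a + n) (Finset.Icc a (a + n - 1)) := by
      ext j
      simp only [Finset.mem_Icc, Finset.mem_insert]
      omega
    rw [this, Finset.sum_insert (by simp), ih]
    push_cast
    rw [← add_assoc]
    ring

end Telescoping

/-! ### The truncated Haar expansion of the kernel -/

/-- The simple function whose stochastic integral is `X₂^J(u,v)`. -/
noncomputable def lowApprox (α u v : ℝ) (J : ℕ) : SimpleFunc ℝ ℝ :=
  dyadicSum (fun j => (2 : ℝ) ^ (-(j : ℝ) * v)) (fun j k =>
    (theta α ((2 : ℝ) ^ j * u + k) v - theta α k v) • (2 : ℝ) ^ ((j : ℝ) / α) •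
      haarAt j (-(k : ℤ))) J

theorem lowApprox_apply (α u v : ℝ) (J : ℕ) (s : ℝ) :
    lowApprox α u v J s = ∑ j ∈ Finset.Icc (1 - (J : ℤ)) ((J : ℤ) - 1),
      ∑ k ∈ Finset.Icc (1 : ℕ) (2 ^ (J - j.natAbs)), (2 : ℝ) ^ (-(j : ℝ) * (v - 1 / α)) *
        ((theta α ((2 : ℝ) ^ j * u + k) v - theta α k v) * haar ((2 : ℝ) ^ j * s + k)) := by
  rw [lowApprox, dyadicSum, coe_simpleFunc_sum]
  refine Finset.sum_congr rfl fun j _ => ?_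
  rw [SimpleFunc.smul_apply, coe_simpleFunc_sum, Finset.smul_sum]
  refine Finset.sum_congr rfl fun k _ => ?_
  rw [SimpleFunc.smul_apply, SimpleFunc.smul_apply, haarAt_neg_apply,
    show -(j : ℝ) * (v - 1 / α) = -(j : ℝ) * v + (j : ℝ) / α by ring,
    Real.rpow_add (by norm_num)]
  simp only [smul_eq_mul]
  ring

theorem finMeasSupp_lowApprox (α u v : ℝ) (J : ℕ) :
    (lowApprox α u v J).FinMeasSupp volume :=
  finMeasSupp_sum _ fun _ _ => finMeasSupp_smul _ (finMeasSupp_sum _ fun _ _ =>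
    finMeasSupp_smul _ (finMeasSupp_smul _ (finMeasSupp_haarAt _ _)))

theorem simpleIntegral_lowApprox_ae_eq {Ω : Type*} [MeasurableSpace Ω] {P : Measure Ω} {α : ℝ}
    {Z : Set ℝ → Ω → ℝ} (hZ : IsStableRandomMeasure P α Z) (u v : ℝ) (J : ℕ) :
    ∀ᵐ ω ∂P, simpleIntegral Z (lowApprox α u v J) ω = haarLowSum α Z J u v ω := by
  set H : ℤ → ℕ → SimpleFunc ℝ ℝ := fun j k => (2 : ℝ) ^ ((j : ℝ) / α) • haarAt j (-(k : ℤ))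
  set d : ℤ → ℕ → ℝ := fun j k => theta α ((2 : ℝ) ^ j * u + k) v - theta α k v
  have hH : ∀ j k, (H j k).FinMeasSupp volume :=
    fun j k => finMeasSupp_smul _ (finMeasSupp_haarAt j k)
  have hd : ∀ j k, (d j k • H j k).FinMeasSupp volume := fun j k => finMeasSupp_smul _ (hH j k)
  have h1 := simpleIntegral_sum_ae_eq hZ (Finset.Icc (1 - (J : ℤ)) ((J : ℤ) - 1))
    (f := fun j => (2 : ℝ) ^ (-(j : ℝ) * v) •
      ∑ k ∈ Finset.Icc (1 : ℕ) (2 ^ (J - j.natAbs)), d j k • H j k)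
    (fun j _ => finMeasSupp_smul _ (finMeasSupp_sum _ fun k _ => hd j k))
  have h2 := ae_all_iff.2 fun j : ℤ => simpleIntegral_smul_ae_eq hZ ((2 : ℝ) ^ (-(j : ℝ) * v))
    (finMeasSupp_sum (Finset.Icc (1 : ℕ) (2 ^ (J - j.natAbs))) fun k _ => hd j k)
  have h3 := ae_all_iff.2 fun j : ℤ => simpleIntegral_sum_ae_eq hZ
    (Finset.Icc (1 : ℕ) (2 ^ (J - j.natAbs))) fun k _ => hd j k
  have h4 := ae_all_iff.2 fun j : ℤ => ae_all_iff.2 fun k : ℕ =>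
    simpleIntegral_smul_ae_eq hZ (d j k) (hH j k)
  have h5 := ae_all_iff.2 fun j : ℤ => ae_all_iff.2 fun k : ℕ =>
    simpleIntegral_smul_ae_eq hZ ((2 : ℝ) ^ ((j : ℝ) / α)) (finMeasSupp_haarAt j k)
  filter_upwards [h1, h2, h3, h4, h5] with ω h1 h2 h3 h4 h5
  refine h1.trans ?_
  rw [haarLowSum]
  refine Finset.sum_congr rfl fun j _ => ?_
  rw [h2 j, h3 j]
  congr 1
  refine Finset.sum_congr rfl fun k _ => ?_
  rw [h4 j k, h5 j k, zeta_eq, mul_comm]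

theorem sum_mul_haar_eq_ite {y : ℝ} (hy : y < 0) (F : ℝ → ℝ) (K : ℕ) :
    ∑ k ∈ Finset.Icc 1 K, F k * haar (y + k)
      = if -⌊y⌋ ≤ (K : ℤ) then F (-⌊y⌋ : ℤ) * haar (y + (-⌊y⌋ : ℤ)) else 0 := by
  have hk := one_le_neg_floor hy
  have hz : ∀ k : ℕ, (k : ℤ) ≠ -⌊y⌋ → F k * haar (y + k) = 0 := by
    intro k hk
    by_contra hne
    exact hk (eq_neg_floor_of_haar_ne_zero (by simpa using right_ne_zero_of_mul hne))
  split_ifs with h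
  · have hc : ((-⌊y⌋).toNat : ℤ) = -⌊y⌋ := Int.toNat_of_nonneg (by omega)
    have hcR : (((-⌊y⌋).toNat : ℕ) : ℝ) = ((-⌊y⌋ : ℤ) : ℝ) := by
      exact_mod_cast congrArg (Int.cast (R := ℝ)) hc
    rw [Finset.sum_eq_single_of_mem (-⌊y⌋).toNat (by rw [Finset.mem_Icc]; omega), hcR]
    intro k _ hne
    exact hz k (by omega)
  · refine Finset.sum_eq_zero fun k hk => hz k ?_
    rw [Finset.mem_Icc] at hk
    omega

/-- At s < 0 only the index -⌊2^j s⌋ matters on level j. The truncation keeps it on every negative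
level once -s ≤ 2^J, and on level n ≥ 0 exactly when -s 4^n ≤ 2^J. The kept levels are consecutive,
so the sum telescopes. -/
theorem tendsto_lowApprox_apply {α u v : ℝ} (hv : 1 / α < v) (hv1 : v - 1 / α < 1) (hu : 0 ≤ u)
    {s : ℝ} (hs : s ≠ 0) :
    Tendsto (fun J => lowApprox α u v J s) atTop (𝓝 (lowKernel α u v s)) := by
  have hκ : 0 < v - 1 / α := by linarith
  rcases hs.lt_or_gt with hs | hs
  · have hker : lowKernel α u v s = (u - s) ^ (v - 1 / α) - (-s) ^ (v - 1 / α) := by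
      rw [lowKernel, indicator_of_mem (show s ∈ Iic 0 from hs.le), posPow, posPow,
        if_pos (by linarith), if_pos (by linarith)]
    rw [hker]
    -- The last level kept at s. The default value 0 of the search is harmless, since level 0 passes
    -- the test once -s ≤ 2^J.
    set N : ℕ → ℕ := fun J => Nat.findGreatest (fun n => -s * 4 ^ n ≤ 2 ^ J) (J - 1) with hN
    have hNtop : Tendsto N atTop atTop := by
      rw [tendsto_atTop]
      intro M
      have hb := (tendsto_pow_atTop_atTop_of_one_lt
        (show (1 : ℝ) < 2 by norm_num)).eventually_ge_atTop
        (-s * 4 ^ M)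
      filter_upwards [hb, eventually_ge_atTop (M + 1)] with J h1 h2
      exact Nat.le_findGreatest (by omega) h1
    have hsum : ∀ᶠ J in atTop, lowApprox α u v J s
        = kernelMean (v - 1 / α) u s ((N J : ℤ) + 1)
          - kernelMean (v - 1 / α) u s (1 - (J : ℤ)) := by
      have hb := (tendsto_pow_atTop_atTop_of_one_lt
        (show (1 : ℝ) < 2 by norm_num)).eventually_ge_atTop
        (-s)
      filter_upwards [hb, eventually_ge_atTop 1] with J hJs hJ1
      have hNle : N J ≤ J - 1 := Nat.findGreatest_le _
      have hNspec : -s * 4 ^ (N J) ≤ 2 ^ J :=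
        Nat.findGreatest_spec (P := fun n => -s * (4 : ℝ) ^ n ≤ 2 ^ J) (m := 0) (Nat.zero_le _)
          (by simpa using hJs)
      have htel := sum_Icc_int_telescope (kernelMean (v - 1 / α) u s) (a := 1 - (J : ℤ)) (N J + J)
      rw [show (1 - (J : ℤ)) + ((N J + J : ℕ) : ℤ) = (N J : ℤ) + 1 by push_cast; ring] at htel
      rw [← htel, add_sub_cancel_right, lowApprox_apply,
        ← Finset.sum_subset (s₁ := Finset.Icc (1 - (J : ℤ)) (N J))
          (Finset.Icc_subset_Icc le_rfl (by omega))]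
      · refine Finset.sum_congr rfl fun j hj => ?_
        rw [Finset.mem_Icc] at hj
        have hy : (2 : ℝ) ^ j * s < 0 := mul_neg_of_pos_of_neg (by positivity) hs
        rw [kernelMean_succ_sub hv hu hs, ← Finset.mul_sum,
          sum_mul_haar_eq_ite hy (fun x => theta α ((2 : ℝ) ^ j * u + x) v - theta α x v), if_pos]
        rw [neg_le, Int.le_floor]
        push_cast
        rcases le_total 0 j with h0 | h0
        · obtain ⟨n, rfl⟩ := Int.eq_ofNat_of_zero_le h0
          have hnN : n ≤ N J := by omega
          have h4 : -s * 4 ^ n ≤ 2 ^ J :=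
            (mul_le_mul_of_nonneg_left (pow_le_pow_right₀ (by norm_num) hnN)
              (by linarith)).trans hNspec
          rw [show (4 : ℝ) = 2 * 2 by norm_num, mul_pow,
            show J = (J - n) + n by omega, pow_add] at h4
          have h2n : (0 : ℝ) < 2 ^ n := by positivity
          have : -s * 2 ^ n ≤ 2 ^ (J - n) := by nlinarith
          simp only [Int.natAbs_natCast, zpow_natCast]
          linarith
        · obtain ⟨n, hn⟩ := Int.eq_ofNat_of_zero_le (show 0 ≤ -j by omega)
          obtain rfl : j = -(n : ℤ) := by omega
          rw [show J = (J - n) + n by omega, pow_add] at hJs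
          simp only [Int.natAbs_neg, Int.natAbs_natCast, zpow_neg, zpow_natCast]
          have h2n : (0 : ℝ) < 2 ^ n := by positivity
          rw [neg_le, ← mul_neg, inv_mul_le_iff₀ h2n]
          linarith
      · intro j hj hj'
        rw [Finset.mem_Icc] at hj hj'
        have hy : (2 : ℝ) ^ j * s < 0 := mul_neg_of_pos_of_neg (by positivity) hs
        rw [← Finset.mul_sum,
          sum_mul_haar_eq_ite hy (fun x => theta α ((2 : ℝ) ^ j * u + x) v - theta α x v), if_neg,
          mul_zero]
        rw [neg_le, Int.le_floor]
        push_cast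
        obtain ⟨n, rfl⟩ := Int.eq_ofNat_of_zero_le (show 0 ≤ j by omega)
        have hgr : ¬(-s * 4 ^ n ≤ 2 ^ J) :=
          Nat.findGreatest_is_greatest (P := fun n => -s * (4 : ℝ) ^ n ≤ 2 ^ J)
            (show N J < n by omega) (by omega)
        intro hcon
        apply hgr
        simp only [Int.natAbs_natCast, zpow_natCast] at hcon
        rw [show (4 : ℝ) = 2 * 2 by norm_num, mul_pow,
            show J = (J - n) + n by omega, pow_add]
        have h2n : (0 : ℝ) < 2 ^ n := by positivity
        nlinarith
    refine Tendsto.congr' (hsum.mono fun _ h => h.symm) ?_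
    have h1 : Tendsto (fun J => (N J : ℤ) + 1) atTop atTop :=
      tendsto_atTop_add_const_right _ _ (tendsto_natCast_atTop_atTop.comp hNtop)
    simpa using ((tendsto_kernelMean_atTop hκ hu hs).comp h1).sub
      (tendsto_kernelMean_atBot hκ hv1 hu hs)
  · rw [lowKernel, indicator_of_notMem (by simpa using hs)]
    refine tendsto_const_nhds.congr fun J => ?_
    rw [lowApprox_apply]
    symm
    refine Finset.sum_eq_zero fun j _ => Finset.sum_eq_zero fun k hk => ?_
    rw [haar_eq_zero, mul_zero, mul_zero]
    intro h
    have hk1 : (1 : ℝ) ≤ k := by exact_mod_cast (Finset.mem_Icc.1 hk).1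
    have : 0 < (2 : ℝ) ^ j * s := by positivity
    linarith [h.2]

/-! ### Coefficient bounds uniform over a dyadic block. -/

section Coefficients

variable {α u v : ℝ} {j : ℤ} {K k : ℕ}

theorem min_one_div_le (hu : u ∈ Icc (0 : ℝ) 1) (hK : 1 ≤ K) (hKk : K ≤ k) :
    min 1 ((2 : ℝ) ^ j * u / k) ≤ min 1 ((2 : ℝ) ^ j / K) := by
  have hK0 : (0 : ℝ) < K := by exact_mod_cast hK
  have hKk' : (K : ℝ) ≤ k := by exact_mod_cast hKk
  have hp : (0 : ℝ) < 2 ^ j := by positivity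
  refine min_le_min le_rfl (div_le_div₀ hp.le ?_ hK0 hKk')
  exact mul_le_of_le_one_right hp.le hu.2

theorem abs_haarCoeff_le (hv : 1 / α < v) (hv1 : v - 1 / α < 1) (hu : u ∈ Icc (0 : ℝ) 1)
    (hK : 1 ≤ K) (hKk : K ≤ k) :
    |theta α ((2 : ℝ) ^ j * u + k) v - theta α k v|
      ≤ 8 * (K : ℝ) ^ (v - 1 / α - 1) * min 1 ((2 : ℝ) ^ j / K) := by
  have hw : 0 ≤ (2 : ℝ) ^ j * u := mul_nonneg (by positivity) hu.1
  have hK0 : (0 : ℝ) < K := by exact_mod_cast hK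
  have hKk' : (K : ℝ) ≤ k := by exact_mod_cast hKk
  have h0 : 0 ≤ min 1 ((2 : ℝ) ^ j * u / k) := le_min zero_le_one (by positivity)
  refine (abs_theta_sub_theta_le hv hv1 hw (hK.trans hKk)).trans ?_
  have h1 : (k : ℝ) ^ (v - 1 / α - 1) ≤ (K : ℝ) ^ (v - 1 / α - 1) :=
    Real.rpow_le_rpow_of_nonpos hK0 hKk' (by linarith)
  exact mul_le_mul (by linarith) (min_one_div_le hu hK hKk) h0 (by positivity)

theorem abs_haarCoeff_diff_le (hv : 1 / α < v) (hv1 : v - 1 / α < 1) (hu : u ∈ Icc (0 : ℝ) 1)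
    (hK : 1 ≤ K) (hKk : K ≤ k) :
    |(theta α ((2 : ℝ) ^ j * u + k) v - theta α k v)
      - (theta α ((2 : ℝ) ^ j * u + (k + 1 : ℕ)) v - theta α (k + 1 : ℕ) v)|
      ≤ 8 * (K : ℝ) ^ (v - 1 / α - 2) * min 1 ((2 : ℝ) ^ j / K) := by
  have hw : 0 ≤ (2 : ℝ) ^ j * u := mul_nonneg (by positivity) hu.1
  have hK0 : (0 : ℝ) < K := by exact_mod_cast hK
  have hKk' : (K : ℝ) ≤ k := by exact_mod_cast hKk
  have h0 : 0 ≤ min 1 ((2 : ℝ) ^ j * u / k) := le_min zero_le_one (by positivity)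
  refine (abs_theta_sub_theta_diff_le hv hv1 hw (hK.trans hKk)).trans ?_
  have h1 : (k : ℝ) ^ (v - 1 / α - 2) ≤ (K : ℝ) ^ (v - 1 / α - 2) :=
    Real.rpow_le_rpow_of_nonpos hK0 hKk' (by linarith)
  exact mul_le_mul (by linarith) (min_one_div_le hu hK hKk) h0 (by positivity)

end Coefficients

theorem eLpNorm_coe_sum_le {ι : Type*} {p : ENNReal} (hp : 1 ≤ p) (S : Finset ι)
    (f : ι → SimpleFunc ℝ ℝ) :
    eLpNorm (∑ i ∈ S, f i : SimpleFunc ℝ ℝ) p volume ≤ ∑ i ∈ S, eLpNorm (f i) p volume := by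
  have : ⇑(∑ i ∈ S, f i) = ∑ i ∈ S, ⇑(f i) := by
    funext s
    rw [coe_simpleFunc_sum, Finset.sum_apply]
  rw [this]
  exact eLpNorm_sum_le (fun i _ => (f i).aestronglyMeasurable) hp

theorem measurable_lowKernel (α u v : ℝ) : Measurable (lowKernel α u v) := by
  have h : ∀ x : ℝ, Measurable fun s : ℝ => posPow (x - s) (v - 1 / α) := fun x =>
    Measurable.ite (measurableSet_lt measurable_const (by fun_prop)) (by fun_prop) measurable_const
  have h0 := h 0
  simp only [zero_sub] at h0
  exact ((h u).sub h0).indicator measurableSet_Iic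

/-! ### Convergence of the truncated kernel in L^α. -/

section Approximation

variable {α : ℝ}

/-- A block has at most 2K indices and coefficients of order K^{v-1/α-1}, so disjoint supports give
K^{v-1}: the level weight with ε = 0. -/
theorem exists_eLpNorm_lowApprox_succ_sub_le (hα : 1 < α) (hα2 : α < 2) {v : ℝ} (hv : 1 / α < v)
    (hv1 : v < 1) : ∃ C : ℝ, 0 ≤ C ∧ ∀ u ∈ Icc (0 : ℝ) 1, ∀ J : ℕ,
      eLpNorm (lowApprox α u v (J + 1) - lowApprox α u v J : SimpleFunc ℝ ℝ) (ENNReal.ofReal α)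
        volume ≤ ENNReal.ofReal (C * ((2 : ℝ) ^ (-(1 - v))) ^ J) := by
  have hα0 : 0 < α := by linarith
  have hinv : 1 / α ≤ 1 := by rw [div_le_one hα0]; exact hα.le
  have hinv2 : 1 / 2 < 1 / α := one_div_lt_one_div_of_lt hα0 hα2
  have hinv0 : 0 < 1 / α := by positivity
  obtain ⟨C, hC0, hC⟩ := exists_sum_level_weight_le (a := v) le_rfl zero_lt_one (by linarith)
  refine ⟨16 * C, by positivity, fun u hu J => ?_⟩
  have hone : 1 ≤ ENNReal.ofReal α := by simpa using hα.le
  rw [lowApprox, lowApprox, dyadicSum_succ_sub]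
  refine (eLpNorm_coe_sum_le hone _ _).trans ?_
  have hlevel : ∀ j ∈ Finset.Icc (-(J : ℤ)) J,
      eLpNorm ((2 : ℝ) ^ (-(j : ℝ) * v) •
        ∑ k ∈ Finset.Ioc (dyadicCut J j) (dyadicCut (J + 1) j),
          (theta α ((2 : ℝ) ^ j * u + k) v - theta α k v) • (2 : ℝ) ^ ((j : ℝ) / α) •
            haarAt j (-(k : ℤ)) : SimpleFunc ℝ ℝ) (ENNReal.ofReal α) volume
      ≤ ENNReal.ofReal (16 * ((2 : ℝ) ^ (-(j : ℝ) * v) *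
          (((2 ^ (J - j.natAbs) : ℕ) : ℝ) ^ (v - 1 + 0)
            * min 1 ((2 : ℝ) ^ j / (2 ^ (J - j.natAbs) : ℕ))))) := by
    intro j hj
    set K := 2 ^ (J - j.natAbs) with hKdef
    have hK : 1 ≤ K := Nat.one_le_two_pow
    have hK0 : (0 : ℝ) < K := by exact_mod_cast hK
    have hmin : 0 ≤ min 1 ((2 : ℝ) ^ j / K) := le_min zero_le_one (by positivity)
    set S := Finset.Ioc (dyadicCut J j) (dyadicCut (J + 1) j) with hS
    have hb := eLpNorm_sum_haarAt_le hα0 j (S := S)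
      (c := fun k => theta α ((2 : ℝ) ^ j * u + k) v - theta α k v)
      (C := 8 * (K : ℝ) ^ (v - 1 / α - 1) * min 1 ((2 : ℝ) ^ j / K)) (by positivity) (by
        intro k hk
        refine abs_haarCoeff_le hv (by linarith) hu hK ?_
        have h1 := le_dyadicCut_add_one J j
        have h2 := (Finset.mem_Ioc.1 hk).1
        omega)
    have hcard : (S.card : ℝ) ≤ 2 * K := by
      have : S.card ≤ 2 * K := by
        rw [hS, Nat.card_Ioc, dyadicCut_succ hj]
        omega
      exact_mod_cast this
    rw [SimpleFunc.coe_smul, eLpNorm_const_smul, Real.enorm_eq_ofReal (by positivity)]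
    refine (mul_le_mul_right hb _).trans ?_
    rw [← ENNReal.ofReal_mul (by positivity)]
    refine ENNReal.ofReal_le_ofReal ?_
    have h1 : (S.card : ℝ) ^ (1 / α) ≤ 2 * (K : ℝ) ^ (1 / α) := by
      refine (Real.rpow_le_rpow (by positivity) hcard hinv0.le).trans ?_
      rw [Real.mul_rpow (by norm_num) hK0.le]
      gcongr
      exact (Real.rpow_le_rpow_of_exponent_le (by norm_num) hinv).trans_eq (Real.rpow_one 2)
    have h2 : (K : ℝ) ^ (v - 1 / α - 1) * (K : ℝ) ^ (1 / α) = (K : ℝ) ^ (v - 1 + 0) := by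
      rw [← Real.rpow_add hK0]
      congr 1
      ring
    calc (2 : ℝ) ^ (-(j : ℝ) * v) * (8 * (K : ℝ) ^ (v - 1 / α - 1) * min 1 ((2 : ℝ) ^ j / K)
          * (S.card : ℝ) ^ (1 / α))
        ≤ (2 : ℝ) ^ (-(j : ℝ) * v) * (8 * (K : ℝ) ^ (v - 1 / α - 1) * min 1 ((2 : ℝ) ^ j / K)
          * (2 * (K : ℝ) ^ (1 / α))) := by gcongr
      _ = _ := by rw [← h2]; ring
  refine (Finset.sum_le_sum hlevel).trans ?_
  rw [← ENNReal.ofReal_sum_of_nonneg fun j _ => by positivity]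
  refine ENNReal.ofReal_le_ofReal ?_
  rw [← Finset.mul_sum, mul_assoc]
  refine mul_le_mul_of_nonneg_left ((hC v le_rfl J).trans_eq ?_) (by norm_num)
  rw [← Real.rpow_natCast, ← Real.rpow_mul (by norm_num)]
  congr 2
  ring

theorem tendsto_eLpNorm_lowApprox_sub (hα : 1 < α) (hα2 : α < 2) {u v : ℝ}
    (hu : u ∈ Icc (0 : ℝ) 1) (hv : 1 / α < v) (hv1 : v < 1) :
    Tendsto (fun J => eLpNorm (fun s => lowApprox α u v J s - lowKernel α u v s)
      (ENNReal.ofReal α) volume) atTop (𝓝 0) := by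
  obtain ⟨C, hC0, hC⟩ := exists_eLpNorm_lowApprox_succ_sub_le hα hα2 hv hv1
  have hinv0 : 0 < 1 / α := by positivity
  set r := (2 : ℝ) ^ (-(1 - v)) with hr
  have hr0 : 0 ≤ r := by positivity
  have hr1 : r < 1 := Real.rpow_lt_one_of_one_lt_of_neg (by norm_num) (by linarith)
  have hone : 1 ≤ ENNReal.ofReal α := by simpa using hα.le
  have hcauchy : ∀ J n : ℕ, eLpNorm (lowApprox α u v (J + n) - lowApprox α u v J : SimpleFunc ℝ ℝ)
      (ENNReal.ofReal α) volume ≤ ENNReal.ofReal (C * r ^ J * (1 - r)⁻¹) := by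
    intro J n
    rw [← Nat.add_zero J, Nat.add_assoc, Nat.zero_add,
      ← Finset.sum_range_sub (fun i => lowApprox α u v (J + i)) n]
    refine (eLpNorm_coe_sum_le hone _ _).trans
      ((Finset.sum_le_sum fun i _ => hC u hu (J + i)).trans ?_)
    rw [← ENNReal.ofReal_sum_of_nonneg fun j _ => by positivity]
    refine ENNReal.ofReal_le_ofReal ?_
    simp only [pow_add, ← mul_assoc, add_zero]
    rw [← Finset.mul_sum]
    exact mul_le_mul_of_nonneg_left (geom_sum_range_le hr0 hr1 n) (by positivity)
  have hbound : ∀ J, eLpNorm (fun s => lowApprox α u v J s - lowKernel α u v s)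
      (ENNReal.ofReal α) volume ≤ ENNReal.ofReal (C * r ^ J * (1 - r)⁻¹) := by
    intro J
    -- Fatou's lemma carries the Cauchy bound to the pointwise limit; the sign is reversed because
    -- the increments converge to the kernel minus its truncation.
    rw [← eLpNorm_neg]
    refine (Lp.eLpNorm_lim_le_liminf_eLpNorm
      (f := fun n => ⇑(lowApprox α u v (J + n) - lowApprox α u v J))
      (fun n => SimpleFunc.aestronglyMeasurable _) _ ?_).trans ?_
    · have hne : ∀ᵐ s : ℝ, s ≠ 0 := by simp [ae_iff]
      filter_upwards [hne] with s hs
      have h1 := tendsto_lowApprox_apply hv (by linarith) hu.1 hs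
      have h2 := ((tendsto_add_atTop_iff_nat J).2 h1).sub_const (lowApprox α u v J s)
      simp only [Pi.neg_apply, neg_sub]
      refine h2.congr fun n => ?_
      rw [SimpleFunc.sub_apply, add_comm]
    · exact (liminf_le_liminf (Eventually.of_forall (hcauchy J))).trans (liminf_const _).le
  refine tendsto_of_tendsto_of_tendsto_of_le_of_le tendsto_const_nhds ?_ (fun _ => zero_le) hbound
  have := (((tendsto_pow_atTop_nhds_zero_of_lt_one hr0 hr1).const_mul C).mul_const (1 - r)⁻¹)
  simpa using ENNReal.tendsto_ofReal this

end Approximation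

/-! ### Growth of the partial sums of the Haar coefficients -/

theorem sum_Ioc_sub_sum_Ioc (x : ℕ → ℝ) {a b : ℕ} (h : a ≤ b) :
    ∑ k ∈ Finset.Ioc 0 b, x k - ∑ k ∈ Finset.Ioc 0 a, x k = ∑ k ∈ Finset.Ioc a b, x k := by
  rw [← Finset.sum_Ioc_consecutive _ (Nat.zero_le a) h, add_sub_cancel_left]

/-- A partial sum is controlled by the sums over dyadic blocks. -/
theorem abs_sum_Ioc_le_of_dyadic_blocks {x : ℕ → ℝ} {n L : ℕ} {β : ℝ} (hβ : 0 ≤ β)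
    (hn : n < 2 ^ L) (hB : ∀ l i : ℕ, (i + 1) * 2 ^ l ≤ n →
      |∑ k ∈ Finset.Ioc (i * 2 ^ l) ((i + 1) * 2 ^ l), x k| ≤ β) :
    |∑ k ∈ Finset.Ioc 0 n, x k| ≤ L * β := by
  -- `n / 2 ^ l * 2 ^ l` is n with its lowest l binary digits cleared; clearing one more digit
  -- removes at most one dyadic block.
  have key : ∀ l : ℕ, |∑ k ∈ Finset.Ioc 0 n, x k - ∑ k ∈ Finset.Ioc 0 (n / 2 ^ l * 2 ^ l), x k|
      ≤ l * β := by
    intro l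
    induction l with
    | zero => simp
    | succ l ih =>
      have hstep : |∑ k ∈ Finset.Ioc 0 (n / 2 ^ l * 2 ^ l), x k
          - ∑ k ∈ Finset.Ioc 0 (n / 2 ^ (l + 1) * 2 ^ (l + 1)), x k| ≤ β := by
        rw [pow_succ, ← Nat.div_div_eq_div_mul]
        set q := n / 2 ^ l with hq
        have hqn : q * 2 ^ l ≤ n := Nat.div_mul_le_self n _
        rcases Nat.even_or_odd' q with ⟨i, hi | hi⟩
        · rw [hi, Nat.mul_div_cancel_left i (by norm_num),
            show i * (2 ^ l * 2) = 2 * i * 2 ^ l by ring]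
          simpa using hβ
        · have h2 : q / 2 = i := by omega
          rw [h2, show i * (2 ^ l * 2) = 2 * i * 2 ^ l by ring]
          rw [hi] at hqn ⊢
          rw [sum_Ioc_sub_sum_Ioc _ (Nat.mul_le_mul_right _ (Nat.le_succ _))]
          exact hB l (2 * i) hqn
      have := abs_sub_le (∑ k ∈ Finset.Ioc 0 n, x k)
        (∑ k ∈ Finset.Ioc 0 (n / 2 ^ l * 2 ^ l), x k)
        (∑ k ∈ Finset.Ioc 0 (n / 2 ^ (l + 1) * 2 ^ (l + 1)), x k)
      push_cast
      linarith
  have := key L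
  rw [Nat.div_eq_of_lt hn] at this
  simpa using this

theorem exists_log_two_le_rpow {ε : ℝ} (hε : 0 < ε) :
    ∃ C : ℝ, 0 ≤ C ∧ ∀ n : ℕ, 1 ≤ n → ((Nat.log 2 n + 1 : ℕ) : ℝ) ≤ C * (n : ℝ) ^ ε := by
  have hl2 : 0 < Real.log 2 := Real.log_pos (by norm_num)
  refine ⟨1 / (ε * Real.log 2) + 1, by positivity, fun n hn => ?_⟩
  have hn' : (1 : ℝ) ≤ n := by exact_mod_cast hn
  have h1 : ((Nat.log 2 n : ℕ) : ℝ) * Real.log 2 ≤ Real.log n := by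
    rw [← Real.log_pow]
    refine Real.log_le_log (by positivity) ?_
    exact_mod_cast Nat.pow_log_le_self 2 (by omega)
  have h2 := Real.log_le_rpow_div (Nat.cast_nonneg n) hε
  have h3 : 1 ≤ (n : ℝ) ^ ε := Real.one_le_rpow hn' hε.le
  have h4 : ((Nat.log 2 n : ℕ) : ℝ) ≤ 1 / (ε * Real.log 2) * (n : ℝ) ^ ε := by
    rw [← le_div_iff₀ hl2] at h1
    refine h1.trans ((div_le_div_of_nonneg_right h2 hl2.le).trans_eq ?_)
    field_simp
  push_cast
  linarith

theorem summable_one_add_nat_rpow {p : ℝ} (hp : 1 < p) :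
    Summable fun n : ℕ => (1 + (n : ℝ)) ^ (-p) := by
  have := (summable_nat_add_iff 1).2 (Real.summable_nat_rpow.2 (show -p < -1 by linarith))
  refine this.congr fun n => ?_
  push_cast
  rw [add_comm]

theorem summable_one_add_natAbs_rpow {p : ℝ} (hp : 1 < p) :
    Summable fun j : ℤ => (1 + (j.natAbs : ℝ)) ^ (-p) := by
  have h := summable_one_add_nat_rpow hp
  exact Summable.of_nat_of_neg (by simpa using h) (by simpa using h)

theorem summable_mul_mul_of_nonneg {ι₁ ι₂ ι₃ : Type*} {f : ι₁ → ℝ} {g : ι₂ → ℝ} {h : ι₃ → ℝ}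
    (hf : Summable f) (hg : Summable g) (hh : Summable h) (hf0 : 0 ≤ f) (hg0 : 0 ≤ g)
    (hh0 : 0 ≤ h) : Summable fun p : ι₁ × ι₂ × ι₃ => f p.1 * (g p.2.1 * h p.2.2) :=
  hf.mul_of_nonneg (hg.mul_of_nonneg hh hg0 hh0) hf0
    (fun q => mul_nonneg (hg0 q.1) (hh0 q.2))

section PartialSums

variable {Ω : Type*} [MeasurableSpace Ω] {P : Measure Ω} [IsProbabilityMeasure P] {α : ℝ}
  {Z : Set ℝ → Ω → ℝ}

theorem measurable_zeta {Ω : Type*} [MeasurableSpace Ω] {P : Measure Ω} {α : ℝ}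
    {Z : Set ℝ → Ω → ℝ} (hZ : IsStableRandomMeasure P α Z) (j : ℤ) (k : ℕ) :
    Measurable (zeta α Z j (-(k : ℤ))) :=
  (measurable_simpleIntegral hZ (finMeasSupp_haarAt j k)).const_mul _

theorem tail_sum_zeta_le (hZ : IsStableRandomMeasure P α Z) (hα : 0 < α) (j : ℤ) (S : Finset ℕ)
    {r : ℝ} (hr : 0 < r) :
    P.real {ω | r < |∑ k ∈ S, zeta α Z j (-(k : ℤ)) ω|}
      ≤ 2 * (2 * (S.card : ℝ) ^ (1 / α) / r) ^ α := by
  set f : SimpleFunc ℝ ℝ :=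
    ∑ k ∈ S, (1 : ℝ) • (2 : ℝ) ^ ((j : ℝ) / α) • haarAt j (-(k : ℤ)) with hf
  have hH : ∀ k : ℕ, ((2 : ℝ) ^ ((j : ℝ) / α) • haarAt j (-(k : ℤ))).FinMeasSupp volume :=
    fun k => finMeasSupp_smul _ (finMeasSupp_haarAt j k)
  have hfin : f.FinMeasSupp volume := finMeasSupp_sum _ fun k _ => finMeasSupp_smul _ (hH k)
  have hae : ∀ᵐ ω ∂P, simpleIntegral Z f ω = ∑ k ∈ S, zeta α Z j (-(k : ℤ)) ω := by
    filter_upwards [simpleIntegral_sum_ae_eq hZ S fun k _ => finMeasSupp_smul 1 (hH k),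
      ae_all_iff.2 fun k : ℕ => simpleIntegral_smul_ae_eq hZ ((2 : ℝ) ^ ((j : ℝ) / α))
        (finMeasSupp_haarAt j k)] with ω h1 h2
    rw [hf, h1]
    refine Finset.sum_congr rfl fun k _ => ?_
    rw [one_smul, h2 k, zeta_eq]
  have hstab := (isSymStable_simpleIntegral hZ hα hfin).congr_ae hae
  have hnorm : (eLpNorm f (ENNReal.ofReal α) volume).toReal ≤ (S.card : ℝ) ^ (1 / α) := by
    have := eLpNorm_sum_haarAt_le hα j (S := S) (c := fun _ => 1) (C := 1) zero_le_one (by simp)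
    rw [one_mul] at this
    exact ENNReal.toReal_le_of_le_ofReal (by positivity) this
  refine (hstab.tail_le hα ENNReal.toReal_nonneg
    (Finset.measurable_sum _ fun k _ => measurable_zeta hZ j k).aemeasurable hr).trans ?_
  have := ENNReal.toReal_nonneg (a := eLpNorm f (ENNReal.ofReal α) volume)
  gcongr

/-- The sum of `ζ_{j,-k}` over the `i`-th dyadic block of length `2^l`. -/
noncomputable def zetaBlock (α : ℝ) (Z : Set ℝ → Ω → ℝ) (p : ℤ × ℕ × ℕ) (ω : Ω) : ℝ :=
  ∑ k ∈ Finset.Ioc (p.2.2 * 2 ^ p.2.1) ((p.2.2 + 1) * 2 ^ p.2.1), zeta α Z p.1 (-(k : ℤ)) ω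

/-- Borel-Cantelli: at the threshold `R` the tail probability is at most a multiple of (1+|j|)^{-p₀}
(1+i)^{-p₀} 2^{-αεl} with p₀ = 1 + αε, which is summable over all three indices. The finitely many
exceptional blocks go into the random constant. -/
theorem ae_exists_zetaBlock_le (hZ : IsStableRandomMeasure P α Z) (hα : 0 < α) {ε : ℝ}
    (hε : 0 < ε) : ∀ᵐ ω ∂P, ∃ C : ℝ, 0 ≤ C ∧ ∀ p : ℤ × ℕ × ℕ, |zetaBlock α Z p ω|
      ≤ C * ((1 + (p.1.natAbs : ℝ)) * ((1 + (p.2.2 : ℝ)) * 2 ^ p.2.1)) ^ (1 / α + ε) := by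
  set R : ℤ × ℕ × ℕ → ℝ := fun p =>
    ((1 + (p.1.natAbs : ℝ)) * ((1 + (p.2.2 : ℝ)) * 2 ^ p.2.1)) ^ (1 / α + ε) with hR
  have hR0 : ∀ p, 0 < R p := fun p => by simp only [hR]; positivity
  set p₀ := 1 + α * ε with hp₀
  have hp₀1 : 1 < p₀ := by simp only [hp₀]; nlinarith [mul_pos hα hε]
  set c : ℤ × ℕ × ℕ → ℝ := fun p => 2 * 2 ^ α * ((1 + (p.1.natAbs : ℝ)) ^ (-p₀)
    * (((2 : ℝ) ^ (-(α * ε))) ^ p.2.1 * (1 + (p.2.2 : ℝ)) ^ (-p₀))) with hc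
  have hcs : Summable c := by
    have hgeo : Summable fun l : ℕ => ((2 : ℝ) ^ (-(α * ε))) ^ l :=
      summable_geometric_of_lt_one (by positivity)
        (Real.rpow_lt_one_of_one_lt_of_neg (by norm_num) (by linarith [mul_pos hα hε]))
    have h3 := summable_mul_mul_of_nonneg (summable_one_add_natAbs_rpow hp₀1) hgeo
      (summable_one_add_nat_rpow hp₀1) (fun _ => by positivity) (fun _ => by positivity)
      (fun _ => by positivity)
    exact h3.mul_left (2 * 2 ^ α)
  have htail : ∀ p, P {ω | R p < |zetaBlock α Z p ω|} ≤ ENNReal.ofReal (c p) := by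
    intro p
    rw [← ENNReal.ofReal_toReal (measure_ne_top P {ω | R p < |zetaBlock α Z p ω|})]
    refine ENNReal.ofReal_le_ofReal ((tail_sum_zeta_le hZ hα p.1 _ (hR0 p)).trans (le_of_eq ?_))
    have hcard : (Finset.Ioc (p.2.2 * 2 ^ p.2.1) ((p.2.2 + 1) * 2 ^ p.2.1)).card = 2 ^ p.2.1 := by
      rw [Nat.card_Ioc, add_mul, one_mul, Nat.add_sub_cancel_left]
    rw [hcard]
    simp only [hc, hR]
    rw [mul_assoc]
    congr 1
    have hA : (0 : ℝ) < 1 + (p.1.natAbs : ℝ) := by positivity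
    have hI : (0 : ℝ) < 1 + (p.2.2 : ℝ) := by positivity
    have hT : (0 : ℝ) < 2 ^ p.2.1 := by positivity
    have hq : (1 / α + ε) * α = p₀ := by simp only [hp₀]; field_simp
    have hq' : 1 / α * α = 1 := by field_simp
    push_cast
    rw [Real.div_rpow (by positivity) (by positivity), Real.mul_rpow (by norm_num) (by positivity),
      ← Real.rpow_mul hT.le, ← Real.rpow_mul (by positivity), hq, hq', Real.rpow_one,
      Real.mul_rpow hA.le (by positivity), Real.mul_rpow hI.le hT.le, Real.rpow_neg hA.le,
      Real.rpow_neg hI.le]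
    have hT2 : ((2 : ℝ) ^ (-(α * ε))) ^ p.2.1 = 2 ^ p.2.1 / ((2 : ℝ) ^ p.2.1) ^ p₀ := by
      rw [← Real.rpow_natCast _ p.2.1, ← Real.rpow_natCast _ p.2.1, ← Real.rpow_mul (by norm_num),
        ← Real.rpow_mul (by norm_num), ← Real.rpow_sub (by norm_num)]
      congr 1
      simp only [hp₀]
      ring
    rw [hT2]
    field_simp
  have hsum : ∑' p, P {ω | R p < |zetaBlock α Z p ω|} ≠ ⊤ :=
    ne_top_of_le_ne_top hcs.tsum_ofReal_ne_top (ENNReal.tsum_le_tsum htail)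
  filter_upwards [ae_finite_setOfPred_mem hsum] with ω hω
  obtain ⟨M, hM⟩ := (hω.image fun p => |zetaBlock α Z p ω| / R p).bddAbove
  refine ⟨max 1 M, zero_le_one.trans (le_max_left _ _), fun p => ?_⟩
  by_cases hp : R p < |zetaBlock α Z p ω|
  · have h1 : |zetaBlock α Z p ω| / R p ≤ M := hM ⟨p, hp, rfl⟩
    rw [div_le_iff₀ (hR0 p)] at h1
    exact h1.trans (mul_le_mul_of_nonneg_right (le_max_right _ _) (hR0 p).le)
  · refine (not_lt.1 hp).trans ?_
    exact le_mul_of_one_le_left (hR0 p).le (le_max_left _ _)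

/-- The sum up to n splits into at most log₂ n + 1 dyadic blocks ending at or before n. Half of ε
pays for the blocks, half for the logarithm. -/
theorem ae_exists_sum_zeta_le (hZ : IsStableRandomMeasure P α Z) (hα : 0 < α) {ε : ℝ}
    (hε : 0 < ε) : ∀ᵐ ω ∂P, ∃ C : ℝ, 0 ≤ C ∧ ∀ (j : ℤ) (n : ℕ),
      |∑ k ∈ Finset.Ioc 0 n, zeta α Z j (-(k : ℤ)) ω|
        ≤ C * (1 + (j.natAbs : ℝ)) ^ (1 / α + ε) * (n : ℝ) ^ (1 / α + ε) := by
  obtain ⟨D, hD0, hD⟩ := exists_log_two_le_rpow (half_pos hε)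
  have hinv : 0 < 1 / α := by positivity
  filter_upwards [ae_exists_zetaBlock_le hZ hα (half_pos hε)] with ω ⟨C, hC0, hC⟩
  refine ⟨D * C, by positivity, fun j n => ?_⟩
  rcases Nat.eq_zero_or_pos n with rfl | hn
  · simp only [Finset.Ioc_self, Finset.sum_empty, abs_zero]
    positivity
  have hA : (1 : ℝ) ≤ 1 + (j.natAbs : ℝ) := by simp
  have hn1 : (1 : ℝ) ≤ n := by exact_mod_cast hn
  have hb := abs_sum_Ioc_le_of_dyadic_blocks (x := fun k => zeta α Z j (-(k : ℤ)) ω) (n := n)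
    (L := Nat.log 2 n + 1)
    (β := C * ((1 + (j.natAbs : ℝ)) * n) ^ (1 / α + ε / 2)) (by positivity)
    (Nat.lt_pow_succ_log_self (by norm_num) n) (fun l i hli => by
      refine (hC (j, l, i)).trans ?_
      have : (1 + (i : ℝ)) * 2 ^ l ≤ n := by
        rw [add_comm]
        exact_mod_cast hli
      simp only
      gcongr)
  refine hb.trans ?_
  rw [Real.mul_rpow (by positivity) (by positivity)]
  calc ((Nat.log 2 n + 1 : ℕ) : ℝ)
        * (C * ((1 + (j.natAbs : ℝ)) ^ (1 / α + ε / 2) * (n : ℝ) ^ (1 / α + ε / 2)))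
      ≤ (D * (n : ℝ) ^ (ε / 2))
        * (C * ((1 + (j.natAbs : ℝ)) ^ (1 / α + ε) * (n : ℝ) ^ (1 / α + ε / 2))) := by
        gcongr
        · exact hD n hn
        · linarith
    _ = D * C * (1 + (j.natAbs : ℝ)) ^ (1 / α + ε)
        * ((n : ℝ) ^ (1 / α + ε / 2) * (n : ℝ) ^ (ε / 2)) := by ring
    _ = _ := by
        rw [← Real.rpow_add (by linarith)]
        congr 2
        ring

end PartialSums

/-! ### Pathwise convergence -/

theorem sum_Ioc_mul_eq_abel (x D : ℕ → ℝ) {L R : ℕ} (h : L ≤ R) :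
    ∑ k ∈ Finset.Ioc L R, x k * D k
      = (∑ k ∈ Finset.Ioc 0 R, x k) * D (R + 1) - (∑ k ∈ Finset.Ioc 0 L, x k) * D (L + 1)
        + ∑ k ∈ Finset.Ioc L R, (∑ i ∈ Finset.Ioc 0 k, x i) * (D k - D (k + 1)) := by
  induction R, h using Nat.le_induction with
  | base => simp
  | succ R hLR ih =>
    rw [Finset.sum_Ioc_succ_top (by omega), Finset.sum_Ioc_succ_top (by omega) (fun k =>
      (∑ i ∈ Finset.Ioc 0 k, x i) * (D k - D (k + 1))), ih,
      Finset.sum_Ioc_succ_top (Nat.zero_le R) x]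
    ring

/-- In the summation by parts the two boundary terms cost d₁ each and the at most 2K interior terms
cost d₂ each; when d₂ is of order d₁/K these balance. The hypothesis on K and L allows for L = 0
with K = 1, as on a new level. -/
theorem abs_sum_block_le {x D : ℕ → ℝ} {K L R : ℕ} {M q d₁ d₂ : ℝ} (hM : 0 ≤ M) (hq : 0 ≤ q)
    (hKL : K ≤ L + 1) (hLR : L ≤ R) (hRK : R ≤ 2 * K)
    (hS : ∀ n : ℕ, |∑ k ∈ Finset.Ioc 0 n, x k| ≤ M * (n : ℝ) ^ q)
    (hD₁ : ∀ k, K ≤ k → |D k| ≤ d₁) (hD₂ : ∀ k, K ≤ k → |D k - D (k + 1)| ≤ d₂) :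
    |∑ k ∈ Finset.Ioc L R, x k * D k| ≤ M * (2 * K : ℝ) ^ q * (2 * d₁ + 2 * K * d₂) := by
  have hd₁ : 0 ≤ d₁ := (abs_nonneg _).trans (hD₁ K le_rfl)
  have hd₂ : 0 ≤ d₂ := (abs_nonneg _).trans (hD₂ K le_rfl)
  set W := M * (2 * K : ℝ) ^ q with hW
  have hW0 : 0 ≤ W := by positivity
  have hS' : ∀ n, n ≤ 2 * K → |∑ k ∈ Finset.Ioc 0 n, x k| ≤ W := by
    intro n hn
    have hn' : (n : ℝ) ≤ 2 * K := by exact_mod_cast hn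
    refine (hS n).trans ?_
    simp only [hW]
    gcongr
  have h1 : |(∑ k ∈ Finset.Ioc 0 R, x k) * D (R + 1)| ≤ W * d₁ := by
    rw [abs_mul]
    exact mul_le_mul (hS' R hRK) (hD₁ _ (by omega)) (abs_nonneg _) hW0
  have h2 : |(∑ k ∈ Finset.Ioc 0 L, x k) * D (L + 1)| ≤ W * d₁ := by
    rw [abs_mul]
    exact mul_le_mul (hS' L (by omega)) (hD₁ _ (by omega)) (abs_nonneg _) hW0
  have h3 : |∑ k ∈ Finset.Ioc L R, (∑ i ∈ Finset.Ioc 0 k, x i) * (D k - D (k + 1))|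
      ≤ 2 * K * (W * d₂) := by
    refine (Finset.abs_sum_le_sum_abs _ _).trans ?_
    have hterm : ∀ k ∈ Finset.Ioc L R,
        |(∑ i ∈ Finset.Ioc 0 k, x i) * (D k - D (k + 1))| ≤ W * d₂ := by
      intro k hk
      rw [Finset.mem_Ioc] at hk
      rw [abs_mul]
      exact mul_le_mul (hS' k (by omega)) (hD₂ _ (by omega)) (abs_nonneg _) hW0
    refine (Finset.sum_le_card_nsmul _ _ _ hterm).trans ?_
    rw [nsmul_eq_mul, Nat.card_Ioc]
    refine mul_le_mul_of_nonneg_right ?_ (by positivity)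
    exact_mod_cast (Nat.sub_le R L).trans hRK
  rw [sum_Ioc_mul_eq_abel x D hLR]
  have h4 := abs_add_le ((∑ k ∈ Finset.Ioc 0 R, x k) * D (R + 1)
    - (∑ k ∈ Finset.Ioc 0 L, x k) * D (L + 1))
    (∑ k ∈ Finset.Ioc L R, (∑ i ∈ Finset.Ioc 0 k, x i) * (D k - D (k + 1)))
  have h5 := abs_sub ((∑ k ∈ Finset.Ioc 0 R, x k) * D (R + 1))
    ((∑ k ∈ Finset.Ioc 0 L, x k) * D (L + 1))
  linarith

section Paths

variable {Ω : Type*} {α : ℝ} {Z : Set ℝ → Ω → ℝ}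

theorem haarLowSum_eq_dyadicSum (α : ℝ) (Z : Set ℝ → Ω → ℝ) (J : ℕ) (u v : ℝ) (ω : Ω) :
    haarLowSum α Z J u v ω = dyadicSum (fun j => (2 : ℝ) ^ (-(j : ℝ) * v)) (fun j k =>
      zeta α Z j (-(k : ℤ)) ω * (theta α ((2 : ℝ) ^ j * u + k) v - theta α k v)) J := rfl

/-- The growth K^{1/α+ε} of the partial sums meets coefficients of order K^{v-1/α-1}, leaving the
level weight K^{v-1+ε}. The power of 1 + J comes only from the factor (1+|j|)^{1/α+ε}. -/
theorem exists_abs_haarLowSum_succ_sub_le (hα : 1 < α) {a b ε : ℝ} (ha : 1 / α < a) (hb : b < 1)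
    (hε : 0 < ε) (hε1 : ε < 1) (hεa : ε < 2 * a - 1) {ω : Ω} {C : ℝ} (hC0 : 0 ≤ C)
    (hC : ∀ (j : ℤ) (n : ℕ), |∑ k ∈ Finset.Ioc 0 n, zeta α Z j (-(k : ℤ)) ω|
      ≤ C * (1 + (j.natAbs : ℝ)) ^ (1 / α + ε) * (n : ℝ) ^ (1 / α + ε)) :
    ∃ A : ℝ, 0 ≤ A ∧ ∀ u ∈ Icc (0 : ℝ) 1, ∀ v ∈ Icc a b, ∀ J : ℕ,
      |haarLowSum α Z (J + 1) u v ω - haarLowSum α Z J u v ω|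
        ≤ A * ((1 + (J : ℝ)) ^ (1 / α + ε) * ((2 : ℝ) ^ (-(1 - b))) ^ J) := by
  have hα0 : 0 < α := by linarith
  have hinv : 1 / α ≤ 1 := by rw [div_le_one hα0]; exact hα.le
  have hinv0 : 0 < 1 / α := by positivity
  obtain ⟨B, hB0, hB⟩ := exists_sum_level_weight_le hε.le hε1 hεa
  set q := 1 / α + ε with hq
  have hq0 : 0 ≤ q := by positivity
  refine ⟨128 * C * B, by positivity, fun u hu v hv J => ?_⟩
  have hv0 : 1 / α < v := ha.trans_le hv.1
  have hv1 : v < 1 := hv.2.trans_lt hb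
  rw [haarLowSum_eq_dyadicSum, haarLowSum_eq_dyadicSum, dyadicSum_succ_sub]
  refine (Finset.abs_sum_le_sum_abs _ _).trans ?_
  have hlevel : ∀ j ∈ Finset.Icc (-(J : ℤ)) J,
      |(2 : ℝ) ^ (-(j : ℝ) * v) • ∑ k ∈ Finset.Ioc (dyadicCut J j) (dyadicCut (J + 1) j),
        zeta α Z j (-(k : ℤ)) ω * (theta α ((2 : ℝ) ^ j * u + k) v - theta α k v)|
      ≤ 128 * C * (1 + (J : ℝ)) ^ q * ((2 : ℝ) ^ (-(j : ℝ) * v) *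
          (((2 ^ (J - j.natAbs) : ℕ) : ℝ) ^ (v - 1 + ε)
            * min 1 ((2 : ℝ) ^ j / (2 ^ (J - j.natAbs) : ℕ)))) := by
    intro j hj
    have h1 := le_dyadicCut_add_one J j
    have h2 := dyadicCut_succ hj
    have h3 := dyadicCut_le_succ hj
    set K := 2 ^ (J - j.natAbs) with hKdef
    have hK : 1 ≤ K := Nat.one_le_two_pow
    have hK0 : (0 : ℝ) < K := by exact_mod_cast hK
    set μ := min 1 ((2 : ℝ) ^ j / K) with hμ
    have hμ0 : 0 ≤ μ := le_min zero_le_one (by positivity)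
    have hblock := abs_sum_block_le (x := fun k => zeta α Z j (-(k : ℤ)) ω)
      (D := fun k => theta α ((2 : ℝ) ^ j * u + k) v - theta α k v) (q := q)
      (M := C * (1 + (j.natAbs : ℝ)) ^ q) (by positivity) hq0 h1 h3 h2.le (hC j)
      (fun k hk => abs_haarCoeff_le hv0 (by linarith) hu hK hk)
      (fun k hk => abs_haarCoeff_diff_le hv0 (by linarith) hu hK hk)
    rw [smul_eq_mul, abs_mul, abs_of_pos (by positivity)]
    have hjJ : (1 + (j.natAbs : ℝ)) ^ q ≤ (1 + (J : ℝ)) ^ q := by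
      have : (j.natAbs : ℝ) ≤ J := by
        rw [Finset.mem_Icc] at hj
        exact_mod_cast (show j.natAbs ≤ J by omega)
      gcongr
    have hKq : (2 * K : ℝ) ^ q ≤ 4 * (K : ℝ) ^ q := by
      rw [Real.mul_rpow (by norm_num) hK0.le]
      refine mul_le_mul_of_nonneg_right ?_ (by positivity)
      calc (2 : ℝ) ^ q ≤ 2 ^ (2 : ℝ) :=
            Real.rpow_le_rpow_of_exponent_le (by norm_num) (by linarith)
        _ = 4 := by norm_num
    have e1 : (K : ℝ) * (K : ℝ) ^ (v - 1 / α - 2) = (K : ℝ) ^ (v - 1 / α - 1) := by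
      rw [← Real.rpow_one_add' hK0.le (by linarith)]
      congr 1
      ring
    have e2 : (K : ℝ) ^ q * (K : ℝ) ^ (v - 1 / α - 1) = (K : ℝ) ^ (v - 1 + ε) := by
      rw [← Real.rpow_add hK0]
      congr 1
      simp only [hq]
      ring
    have e3 : 2 * (8 * (K : ℝ) ^ (v - 1 / α - 1) * μ)
        + 2 * K * (8 * (K : ℝ) ^ (v - 1 / α - 2) * μ) = 32 * (K : ℝ) ^ (v - 1 / α - 1) * μ := by
      rw [← e1]
      ring
    rw [e3] at hblock
    calc (2 : ℝ) ^ (-(j : ℝ) * v) * _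
        ≤ (2 : ℝ) ^ (-(j : ℝ) * v) * (C * (1 + (j.natAbs : ℝ)) ^ q * (2 * K : ℝ) ^ q
          * (32 * (K : ℝ) ^ (v - 1 / α - 1) * μ)) := by gcongr
      _ ≤ (2 : ℝ) ^ (-(j : ℝ) * v) * (C * (1 + (J : ℝ)) ^ q * (4 * (K : ℝ) ^ q)
          * (32 * (K : ℝ) ^ (v - 1 / α - 1) * μ)) := by gcongr
      _ = _ := by rw [← e2]; ring
  refine (Finset.sum_le_sum hlevel).trans ?_
  rw [← Finset.mul_sum]
  calc _ ≤ 128 * C * (1 + (J : ℝ)) ^ q * (B * (2 : ℝ) ^ (-(J : ℝ) * (1 - v))) := by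
        gcongr
        exact hB v hv.1 J
    _ ≤ 128 * C * (1 + (J : ℝ)) ^ q * (B * (2 : ℝ) ^ (-(J : ℝ) * (1 - b))) := by
        gcongr 128 * C * (1 + (J : ℝ)) ^ q * (B * ?_)
        refine Real.rpow_le_rpow_of_exponent_le (by norm_num) ?_
        nlinarith [mul_nonneg (Nat.cast_nonneg (α := ℝ) J) (sub_nonneg.2 hv.2)]
    _ = _ := by
        rw [← Real.rpow_natCast ((2 : ℝ) ^ (-(1 - b))), ← Real.rpow_mul (by norm_num),
          show -(1 - b) * (J : ℝ) = -(J : ℝ) * (1 - b) by ring]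
        ring

theorem continuous_theta_comp {X : Type*} [TopologicalSpace X] {f g : X → ℝ} (hf : Continuous f)
    (hg : Continuous g) (hf1 : ∀ x, 1 ≤ f x) (hg1 : ∀ x, 1 / α < g x) :
    Continuous fun x => theta α (f x) (g x) := by
  have h : (fun x => theta α (f x) (g x)) = fun x => powPrim (g x - 1 / α) (f x)
      - 2 * powPrim (g x - 1 / α) (f x - 1 / 2) + powPrim (g x - 1 / α) (f x - 1) :=
    funext fun x => theta_eq_powPrim (hg1 x) (hf1 x)
  have hp : ∀ {k : X → ℝ}, Continuous k → Continuous fun x => powPrim (g x - 1 / α) (k x) :=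
    fun {k} hk => (continuousOn_powPrim (s := {p | 0 < p.1}) fun _ hp => hp).comp_continuous
      (f := fun x => (g x - 1 / α, k x)) (by fun_prop) fun x => sub_pos.2 (hg1 x)
  rw [h]
  exact ((hp hf).sub (continuous_const.mul (hp (hf.sub continuous_const)))).add
    (hp (hf.sub continuous_const))

theorem continuous_haarLowSum {a b : ℝ} (ha : 1 / α < a) (J : ℕ) (ω : Ω) :
    Continuous (fun p : Icc (0 : ℝ) 1 × Icc a b => haarLowSum α Z J p.1 p.2 ω) := by
  have hv : ∀ p : Icc (0 : ℝ) 1 × Icc a b, 1 / α < (p.2 : ℝ) := fun p => ha.trans_le p.2.2.1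
  have hcv : Continuous fun p : Icc (0 : ℝ) 1 × Icc a b => (p.2 : ℝ) := by fun_prop
  refine continuous_finsetSum _ fun j _ => Continuous.mul ?_
    (continuous_finsetSum _ fun k hk => continuous_const.mul (Continuous.sub ?_ ?_))
  · exact Continuous.rpow continuous_const (by fun_prop) fun _ => Or.inl (by norm_num)
  · have hk1 : (1 : ℝ) ≤ k := by exact_mod_cast (Finset.mem_Icc.1 hk).1
    refine continuous_theta_comp (by fun_prop) hcv (fun p => ?_) hv
    have := mul_nonneg (show (0 : ℝ) ≤ 2 ^ j by positivity) p.1.2.1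
    linarith
  · have hk1 : (1 : ℝ) ≤ k := by exact_mod_cast (Finset.mem_Icc.1 hk).1
    exact continuous_theta_comp continuous_const hcv (fun _ => hk1) hv

end Paths

theorem summable_one_add_rpow_mul_pow {q r : ℝ} (hq : q ≤ 2) (hr0 : 0 < r) (hr1 : r < 1) :
    Summable fun n : ℕ => (1 + (n : ℝ)) ^ q * r ^ n := by
  have h1 : Summable fun n : ℕ => (n : ℝ) ^ 2 * r ^ n :=
    summable_pow_mul_geometric_of_norm_lt_one 2 (by rwa [Real.norm_of_nonneg hr0.le])
  have h2 := ((summable_nat_add_iff 1).2 h1).mul_left r⁻¹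
  refine Summable.of_nonneg_of_le (fun n => by positivity) (fun n => ?_) h2
  have hn : (1 + (n : ℝ)) ^ q ≤ (1 + (n : ℝ)) ^ 2 := by
    rw [← Real.rpow_natCast (1 + (n : ℝ)) 2]
    exact Real.rpow_le_rpow_of_exponent_le (by simp) (by simpa using hq)
  have e : r⁻¹ * (((n + 1 : ℕ) : ℝ) ^ 2 * r ^ (n + 1)) = (1 + (n : ℝ)) ^ 2 * r ^ n := by
    rw [pow_succ r]
    push_cast
    field_simp
    ring
  rw [e]
  gcongr

/-- A sequence with polynomially corrected geometric increments converges at the same rate. -/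
theorem exists_tendsto_of_dist_succ_le {E : Type*} [MetricSpace E] [CompleteSpace E]
    {F : ℕ → E} {A q r : ℝ} (hA : 0 ≤ A) (hq0 : 0 ≤ q) (hq : q ≤ 2) (hr0 : 0 < r) (hr1 : r < 1)
    (hF : ∀ J : ℕ, dist (F J) (F (J + 1)) ≤ A * ((1 + (J : ℝ)) ^ q * r ^ J)) :
    ∃ x : E, Tendsto F atTop (𝓝 x) ∧
      ∃ B : ℝ, 0 ≤ B ∧ ∀ J : ℕ, dist (F J) x ≤ B * ((1 + (J : ℝ)) ^ q * r ^ J) := by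
  have hs := summable_one_add_rpow_mul_pow hq hr0 hr1
  obtain ⟨x, hx⟩ := cauchySeq_tendsto_of_complete
    (cauchySeq_of_dist_le_of_summable _ hF (hs.mul_left A))
  refine ⟨x, hx, A * ∑' n : ℕ, (1 + (n : ℝ)) ^ q * r ^ n,
    mul_nonneg hA (tsum_nonneg fun n => by positivity), fun J => ?_⟩
  refine (dist_le_tsum_of_dist_le_of_tendsto _ hF (hs.mul_left A) hx J).trans ?_
  have hsJ := hs.mul_left (A * ((1 + (J : ℝ)) ^ q * r ^ J))
  refine (Summable.tsum_le_tsum (fun n => ?_) ?_ hsJ).trans_eq (by rw [tsum_mul_left]; ring)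
  -- 1 + J + n ≤ (1 + J)(1 + n) pulls the polynomial factor in J out of the tail, leaving a
  -- convergent sum in n.
  · have h1 : (1 + ((J + n : ℕ) : ℝ)) ^ q ≤ (1 + (J : ℝ)) ^ q * (1 + (n : ℝ)) ^ q := by
      rw [← Real.mul_rpow (by positivity) (by positivity)]
      refine Real.rpow_le_rpow (by positivity) ?_ hq0
      push_cast
      nlinarith [mul_nonneg (Nat.cast_nonneg (α := ℝ) J) (Nat.cast_nonneg (α := ℝ) n)]
    calc A * ((1 + ((J + n : ℕ) : ℝ)) ^ q * r ^ (J + n))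
        ≤ A * ((1 + (J : ℝ)) ^ q * (1 + (n : ℝ)) ^ q * r ^ (J + n)) := by gcongr
      _ = _ := by rw [pow_add]; ring
  · have := (summable_nat_add_iff J).2 (hs.mul_left A)
    simpa only [add_comm] using this

/-! ### The limit field: integral representation, stability and rate. -/

section LowFrequencyPart

variable {Ω : Type*} [MeasurableSpace Ω] {P : Measure Ω} [IsProbabilityMeasure P] {α : ℝ}
  {Z : Set ℝ → Ω → ℝ}

theorem measurable_haarLowSum {Ω : Type*} [MeasurableSpace Ω] {P : Measure Ω} {α : ℝ}
    {Z : Set ℝ → Ω → ℝ} (hZ : IsStableRandomMeasure P α Z) (J : ℕ) (u v : ℝ) :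
    Measurable (haarLowSum α Z J u v) :=
  Finset.measurable_sum _ fun j _ => (Finset.measurable_sum _ fun k _ =>
    (measurable_zeta hZ j k).mul_const _).const_mul _

theorem hasStableIntegral_lowKernel (hZ : IsStableRandomMeasure P α Z) (hα : 1 < α) (hα2 : α < 2)
    {u v : ℝ} (hu : u ∈ Icc (0 : ℝ) 1) (hv : 1 / α < v) (hv1 : v < 1) {Y : Ω → ℝ}
    (hY : ∀ᵐ ω ∂P, Tendsto (fun J => haarLowSum α Z J u v ω) atTop (𝓝 (Y ω))) :
    HasStableIntegral P α Z (lowKernel α u v) Y := by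
  refine hasStableIntegral_of_tendsto hZ hα.le (measurable_lowKernel α u v).aestronglyMeasurable
    (fun J => finMeasSupp_lowApprox α u v J) (tendsto_eLpNorm_lowApprox_sub hα hα2 hu hv hv1) ?_
  filter_upwards [hY, ae_all_iff.2 fun J => simpleIntegral_lowApprox_ae_eq hZ u v J] with ω h1 h2
  simpa only [h2] using h1

/-- The combination is an almost sure limit of integrals of combinations of `lowApprox`; these
converge in L^α, and the norm of the limiting integrand is the scale. -/
theorem exists_isSymStable_sum (hZ : IsStableRandomMeasure P α Z) (hα : 1 < α) (hα2 : α < 2)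
    {ι : Type*} (S : Finset ι) (c u v : ι → ℝ) (hu : ∀ i, u i ∈ Icc (0 : ℝ) 1)
    (hv : ∀ i, 1 / α < v i) (hv1 : ∀ i, v i < 1) {Y : ι → Ω → ℝ}
    (hY : ∀ᵐ ω ∂P, ∀ i, Tendsto (fun J => haarLowSum α Z J (u i) (v i) ω) atTop (𝓝 (Y i ω))) :
    ∃ σ : ℝ, 0 ≤ σ ∧ IsSymStable P α σ (fun ω => ∑ i ∈ S, c i * Y i ω) := by
  have hα0 : 0 < α := by linarith
  have hp0 : ENNReal.ofReal α ≠ 0 := by simpa using hα0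
  have hone : 1 ≤ ENNReal.ofReal α := by simpa using hα.le
  set F : ℝ → ℝ := fun s => ∑ i ∈ S, c i * lowKernel α (u i) (v i) s with hF
  set G : ℕ → SimpleFunc ℝ ℝ := fun J => ∑ i ∈ S, c i • lowApprox α (u i) (v i) J with hG
  have hfin : ∀ J i, (c i • lowApprox α (u i) (v i) J).FinMeasSupp volume :=
    fun J i => finMeasSupp_smul _ (finMeasSupp_lowApprox _ _ _ J)
  have hGfin : ∀ J, (G J).FinMeasSupp volume := fun J => finMeasSupp_sum _ fun i _ => hfin J i
  have hGm : ∀ J, MemLp (G J) (ENNReal.ofReal α) volume := fun J =>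
    (SimpleFunc.memLp_iff_finMeasSupp hp0 ENNReal.ofReal_ne_top).2 (hGfin J)
  have hlim : Tendsto (fun J => eLpNorm (fun s => G J s - F s) (ENNReal.ofReal α) volume) atTop
      (𝓝 0) := by
    have hsum : Tendsto (fun J => ∑ i ∈ S, ‖c i‖ₑ * eLpNorm (fun s => lowApprox α (u i) (v i) J s
        - lowKernel α (u i) (v i) s) (ENNReal.ofReal α) volume) atTop (𝓝 0) := by
      have := tendsto_finsetSum S fun i _ => ENNReal.Tendsto.const_mul
        (tendsto_eLpNorm_lowApprox_sub hα hα2 (hu i) (hv i) (hv1 i))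
        (Or.inr (enorm_ne_top (x := c i)))
      simpa using this
    refine tendsto_of_tendsto_of_tendsto_of_le_of_le tendsto_const_nhds hsum (fun _ => zero_le)
      fun J => ?_
    have hfun : (fun s => G J s - F s) = ∑ i ∈ S, c i • fun s => lowApprox α (u i) (v i) J s
        - lowKernel α (u i) (v i) s := by
      funext s
      simp only [hG, hF, coe_simpleFunc_sum, Finset.sum_apply, SimpleFunc.smul_apply, Pi.smul_apply,
        smul_eq_mul, ← Finset.sum_sub_distrib, mul_sub]
    rw [hfun]
    refine (eLpNorm_sum_le (fun i _ => ?_) hone).trans (le_of_eq ?_)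
    · exact ((SimpleFunc.aestronglyMeasurable _).sub
        (measurable_lowKernel _ _ _).aestronglyMeasurable).const_smul _
    · exact Finset.sum_congr rfl fun i _ => eLpNorm_const_smul _ _ _ _
  have hFmeas : AEStronglyMeasurable F volume :=
    (Finset.measurable_sum S fun i _ =>
      (measurable_lowKernel α (u i) (v i)).const_mul (c i)).aestronglyMeasurable
  refine ⟨(eLpNorm F (ENNReal.ofReal α) volume).toReal, ENNReal.toReal_nonneg,
    isSymStable_of_tendsto hα0 (tendsto_toReal_eLpNorm_of_tendsto_sub hα.le
      (memLp_of_tendsto_simpleFunc hFmeas hGm hlim) hGm hlim)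
      (fun J => (measurable_simpleIntegral hZ (hGfin J)).aemeasurable)
      (fun J => isSymStable_simpleIntegral hZ hα0 (hGfin J)) ?_⟩
  have h1 := ae_all_iff.2 fun J => simpleIntegral_sum_ae_eq hZ S fun i _ => hfin J i
  have h2 : ∀ᵐ ω ∂P, ∀ J, ∀ i ∈ S, simpleIntegral Z (c i • lowApprox α (u i) (v i) J) ω
      = c i * haarLowSum α Z J (u i) (v i) ω := by
    refine ae_all_iff.2 fun J => (Finset.eventually_all S).2 fun i _ => ?_
    filter_upwards [simpleIntegral_smul_ae_eq hZ (c i) (finMeasSupp_lowApprox α (u i) (v i) J),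
      simpleIntegral_lowApprox_ae_eq hZ (u i) (v i) J] with ω h3 h4
    rw [h3, h4]
  filter_upwards [hY, h1, h2] with ω hω h1 h2
  refine (tendsto_finsetSum S fun i _ => (hω i).const_mul (c i)).congr fun J => ?_
  rw [h1 J]
  exact Finset.sum_congr rfl fun i hi => (h2 J i hi).symm

theorem isBigO_of_norm_le {f : ℕ → ℝ} {B b q q' : ℝ} (hq0 : 0 ≤ q) (hq : q ≤ 2) (hqq' : q ≤ q')
    (hB : 0 ≤ B) (hf : ∀ J : ℕ, ‖f J‖ ≤ B * ((1 + (J : ℝ)) ^ q * ((2 : ℝ) ^ (-(1 - b))) ^ J)) :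
    f =O[atTop] fun J : ℕ => (2 : ℝ) ^ (-(J : ℝ) * (1 - b)) * (J : ℝ) ^ q' := by
  refine Asymptotics.IsBigO.of_bound (4 * B) ?_
  filter_upwards [eventually_ge_atTop 1] with J hJ
  have hJ' : (1 : ℝ) ≤ J := by exact_mod_cast hJ
  have h1 : (1 + (J : ℝ)) ^ q ≤ 4 * (J : ℝ) ^ q' := by
    calc (1 + (J : ℝ)) ^ q ≤ (2 * (J : ℝ)) ^ q :=
          Real.rpow_le_rpow (by positivity) (by linarith) hq0
      _ = 2 ^ q * (J : ℝ) ^ q := Real.mul_rpow (by norm_num) (by positivity)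
      _ ≤ 4 * (J : ℝ) ^ q' := by
          refine mul_le_mul ?_ (Real.rpow_le_rpow_of_exponent_le hJ' hqq') (by positivity)
            (by norm_num)
          exact (Real.rpow_le_rpow_of_exponent_le (by norm_num) hq).trans_eq (by norm_num)
  have h2 : ((2 : ℝ) ^ (-(1 - b))) ^ J = (2 : ℝ) ^ (-(J : ℝ) * (1 - b)) := by
    rw [← Real.rpow_natCast, ← Real.rpow_mul (by norm_num)]
    congr 1
    ring
  rw [Real.norm_of_nonneg (r := (2 : ℝ) ^ (-(J : ℝ) * (1 - b)) * (J : ℝ) ^ q') (by positivity)]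
  refine (hf J).trans ?_
  rw [h2]
  calc B * ((1 + (J : ℝ)) ^ q * (2 : ℝ) ^ (-(J : ℝ) * (1 - b)))
      ≤ B * (4 * (J : ℝ) ^ q' * (2 : ℝ) ^ (-(J : ℝ) * (1 - b))) := by gcongr
    _ = _ := by ring

/-- The growth condition on the partial sums of the `ζ_{j,-k}` along which the paths converge. -/
def HasSlowPartialSums {Ω : Type*} (α : ℝ) (Z : Set ℝ → Ω → ℝ) (ω : Ω) : Prop :=
  ∀ m : ℕ, ∃ C : ℝ, 0 ≤ C ∧ ∀ (j : ℤ) (n : ℕ), |∑ k ∈ Finset.Ioc 0 n, zeta α Z j (-(k : ℤ)) ω|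
    ≤ C * (1 + (j.natAbs : ℝ)) ^ (1 / α + 1 / ((m : ℝ) + 1))
      * (n : ℝ) ^ (1 / α + 1 / ((m : ℝ) + 1))

theorem HasSlowPartialSums.exists_tendsto {Ω : Type*} {α : ℝ} {Z : Set ℝ → Ω → ℝ} {ω : Ω}
    (h : HasSlowPartialSums α Z ω) (hα : 1 < α) (hα2 : α < 2) {a b : ℝ} (ha : 1 / α < a)
    (hb : b < 1) {η : ℝ} (hη : 0 < η) :
    ∃ x : C(Icc (0 : ℝ) 1 × Icc a b, ℝ),
      Tendsto (fun J : ℕ => (⟨_, continuous_haarLowSum (Z := Z) ha J ω⟩ :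
        C(Icc (0 : ℝ) 1 × Icc a b, ℝ))) atTop (𝓝 x) ∧
      (fun J : ℕ => ‖x - (⟨_, continuous_haarLowSum (Z := Z) ha J ω⟩ :
        C(Icc (0 : ℝ) 1 × Icc a b, ℝ))‖) =O[atTop]
        fun J : ℕ => (2 : ℝ) ^ (-(J : ℝ) * (1 - b)) * (J : ℝ) ^ (1 / α + η) := by
  have hα0 : 0 < α := by linarith
  have hinv : 1 / α < 1 := by rw [div_lt_one hα0]; exact hα
  have hinv0 : 0 < 1 / α := by positivity
  have hinv2 : 1 / 2 < 1 / α := one_div_lt_one_div_of_lt hα0 hα2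
  -- ε = 1/(m+1) must lie below η for the rate, and below 1 and 2a - 1 for the geometric series over
  -- the levels; 2a > 1 because α < 2.
  obtain ⟨m, hm⟩ := exists_nat_one_div_lt (show 0 < min (min 1 η) (2 * a - 1) from
    lt_min (lt_min one_pos hη) (by linarith))
  obtain ⟨hm12, hm3⟩ := lt_min_iff.1 hm
  obtain ⟨hm1, hm2⟩ := lt_min_iff.1 hm12
  obtain ⟨C, hC0, hC⟩ := h m
  set ε := 1 / ((m : ℝ) + 1) with hε
  have hε0 : 0 < ε := by positivity
  obtain ⟨A, hA0, hA⟩ := exists_abs_haarLowSum_succ_sub_le hα ha hb hε0 hm1 hm3 hC0 hC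
  set F : ℕ → C(Icc (0 : ℝ) 1 × Icc a b, ℝ) :=
    fun J => ⟨_, continuous_haarLowSum (Z := Z) ha J ω⟩ with hF
  have hdist : ∀ J : ℕ, dist (F J) (F (J + 1))
      ≤ A * ((1 + (J : ℝ)) ^ (1 / α + ε) * ((2 : ℝ) ^ (-(1 - b))) ^ J) := by
    intro J
    rw [ContinuousMap.dist_le (by positivity)]
    intro p
    rw [dist_comm, Real.dist_eq]
    exact hA p.1 p.1.2 p.2 p.2.2 J
  obtain ⟨x, hx, B, hB0, hB⟩ := exists_tendsto_of_dist_succ_le hA0 (by positivity)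
    (show 1 / α + ε ≤ 2 by linarith) (by positivity)
    (Real.rpow_lt_one_of_one_lt_of_neg (by norm_num) (by linarith)) hdist
  refine ⟨x, hx, isBigO_of_norm_le (by positivity) (show 1 / α + ε ≤ 2 by linarith)
    (by linarith) hB0 fun J => ?_⟩
  rw [norm_norm, ← dist_eq_norm, dist_comm]
  exact hB J

/-- Only countably many exponents are used, so a single event serves all a, b and η. -/
theorem ae_hasSlowPartialSums (hZ : IsStableRandomMeasure P α Z) (hα : 0 < α) :
    ∀ᵐ ω ∂P, HasSlowPartialSums α Z ω :=
  ae_all_iff.2 fun m => ae_exists_sum_zeta_le hZ hα (ε := 1 / ((m : ℝ) + 1)) (by positivity)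

end LowFrequencyPart

end HaarLMSM

/-! ### The convergence theorem. -/

theorem theorem2 {Ω : Type*} [MeasurableSpace Ω] (P : Measure Ω) [IsProbabilityMeasure P]
    (α : ℝ) (hα : 1 < α) (hα2 : α < 2) (Z : Set ℝ → Ω → ℝ)
    (hZ : HaarLMSM.IsStableRandomMeasure P α Z) :
    ∃ E : Set Ω, MeasurableSet E ∧ P E = 1 ∧
      ∀ a b : ℝ, 1 / α < a → a < b → b < 1 →
        ∃ hc : ∀ (J : ℕ) (ω : Ω), Continuous
            (fun p : Icc (0 : ℝ) 1 × Icc a b => HaarLMSM.haarLowSum α Z J p.1 p.2 ω),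
        ∃ X₂ : Ω → C(Icc (0 : ℝ) 1 × Icc a b, ℝ),
          (∀ ω ∈ E,
            Tendsto (fun J : ℕ => (⟨_, hc J ω⟩ : C(Icc (0 : ℝ) 1 × Icc a b, ℝ))) atTop
              (𝓝 (X₂ ω)) ∧
            ∀ η : ℝ, 0 < η →
              (fun J : ℕ => ‖X₂ ω - (⟨_, hc J ω⟩ : C(Icc (0 : ℝ) 1 × Icc a b, ℝ))‖)
                =O[atTop] (fun J : ℕ =>
                  (2 : ℝ) ^ (-(J : ℝ) * (1 - b)) * (J : ℝ) ^ (1 / α + η))) ∧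
          (∀ p : Icc (0 : ℝ) 1 × Icc a b, Measurable (fun ω => X₂ ω p)) ∧
          HaarLMSM.IsSymStableField P α (fun p ω => X₂ ω p) ∧
          (∀ p : Icc (0 : ℝ) 1 × Icc a b,
            HaarLMSM.HasStableIntegral P α Z (HaarLMSM.lowKernel α p.1 p.2)
              (fun ω => X₂ ω p)) := by
  classical
  have hα0 : 0 < α := by linarith
  obtain ⟨E, hE, hEm, hEslow⟩ :=
    (HaarLMSM.ae_hasSlowPartialSums hZ hα0).exists_measurable_mem
  refine ⟨E, hEm, (prob_compl_eq_zero_iff hEm).1 (mem_ae_iff.1 hE), fun a b ha hab hb => ?_⟩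
  -- The limit is chosen once, with η = 1; the limits found for other η agree with it by uniqueness.
  have hlim := fun ω (hω : ω ∈ E) => (hEslow ω hω).exists_tendsto hα hα2 ha hb one_pos
  let X₂ : Ω → C(Icc (0 : ℝ) 1 × Icc a b, ℝ) := fun ω =>
    if h : ω ∈ E then (hlim ω h).choose else 0
  have hX : ∀ ω (h : ω ∈ E), X₂ ω = (hlim ω h).choose := fun ω h => dif_pos h
  have htend : ∀ ω ∈ E, Tendsto (fun J : ℕ =>
      (⟨_, HaarLMSM.continuous_haarLowSum (Z := Z) ha J ω⟩ : C(Icc (0 : ℝ) 1 × Icc a b, ℝ))) atTop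
        (𝓝 (X₂ ω)) := fun ω hω => by
    rw [hX ω hω]
    exact (hlim ω hω).choose_spec.1
  have heval : ∀ ω ∈ E, ∀ p : Icc (0 : ℝ) 1 × Icc a b,
      Tendsto (fun J => HaarLMSM.haarLowSum α Z J p.1 p.2 ω) atTop (𝓝 (X₂ ω p)) :=
    fun ω hω p => ((continuous_eval_const p).tendsto _).comp (htend ω hω)
  have hae : ∀ᵐ ω ∂P, ∀ p : Icc (0 : ℝ) 1 × Icc a b,
      Tendsto (fun J => HaarLMSM.haarLowSum α Z J p.1 p.2 ω) atTop (𝓝 (X₂ ω p)) := by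
    filter_upwards [hE] with ω hω using heval ω hω
  refine ⟨fun J ω => HaarLMSM.continuous_haarLowSum ha J ω, X₂, fun ω hω => ⟨htend ω hω,
    fun η hη => ?_⟩, fun p => ?_, fun n p c => ?_, fun p => ?_⟩
  · obtain ⟨x, hx, hO⟩ := (hEslow ω hω).exists_tendsto hα hα2 ha hb hη
    rwa [tendsto_nhds_unique hx (htend ω hω)] at hO
  -- Since the field is 0 off `E`, it is the limit at every ω of the sums cut off to `E`, so it is
  -- measurable and not merely almost everywhere so.
  · refine measurable_of_tendsto_metrizable (f := fun (J : ℕ) ω => if ω ∈ E then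
      HaarLMSM.haarLowSum α Z J p.1 p.2 ω else 0) (fun J => Measurable.ite hEm
        (HaarLMSM.measurable_haarLowSum hZ J p.1 p.2) measurable_const) ?_
    rw [tendsto_pi_nhds]
    intro ω
    by_cases hω : ω ∈ E
    · simpa only [if_pos hω] using heval ω hω p
    · have h0 : X₂ ω = 0 := dif_neg hω
      simp [hω, h0]
  · exact HaarLMSM.exists_isSymStable_sum hZ hα hα2 Finset.univ c (fun i => ((p i).1 : ℝ))
      (fun i => ((p i).2 : ℝ)) (fun i => (p i).1.2) (fun i => ha.trans_le (p i).2.2.1)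
      (fun i => (p i).2.2.2.trans_lt hb) (hae.mono fun ω h i => h (p i))
  · exact HaarLMSM.hasStableIntegral_lowKernel hZ hα hα2 p.1.2 (ha.trans_le p.2.2.1)
      (p.2.2.2.trans_lt hb) (hae.mono fun ω h => h p)
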